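/- **Theorem 1.1.** Let $n\ge 2$ and let $p=p_c(n)$ be the positive root of the quadratic equation $(n-1)p^2-(n+1)p-2=0$. Let $R>0$ and let $(u_0,u_1)\in H^1(\mathbb R^n)\times L^2(\mathbb R^n)$ be real-valued with $u_0(x)=u_1(x)=0$ for almost every $|x|>R$, with $u_0\ge 0$ and $u_1\ge 0$ almost everywhere, and with $u_0$ and $u_1$ not both zero almost everywhere. Let $0<T\le\infty$, and suppose that the problem $$\Delta u-\partial_t^2u+|u|^p=0,\qquad u(x,0)=u_0(x),\quad u_t(x,0)=u_1(x),\qquad x\in\mathbb R^n,$$ has a solution (in the sense of distributions on $\mathbb R^n\times(0,T)$, with the initial values attained by continuity) such that $(u,u_t)\in C([0,T),\,H^1(\mathbb R^n)\times L^2(\mathbb R^n))$ and $$\operatorname{supp}(u,u_t)\subset\{(x,t):|x|\le t+R\}.$$ Then $T<\infty$. That is, no such solution is global in time. -/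

import Mathlib

open MeasureTheory
open scoped ContDiff Gradient Laplacian

namespace CriticalWave

/-- Euclidean space `ℝⁿ`. -/
abbrev Space (n : ℕ) : Type := EuclideanSpace ℝ (Fin n)

/-- The real Hilbert space `L²(ℝⁿ)`. -/
abbrev L2 (n : ℕ) : Type := Lp ℝ 2 (volume : Measure (Space n))

/-- The Hilbert space `L²(ℝⁿ; ℝⁿ)` of square-integrable vector fields. -/
abbrev L2Field (n : ℕ) : Type := Lp (Space n) 2 (volume : Measure (Space n))

/-- `φ ∈ C_c^∞(ℝⁿ)`. -/
structure IsTestFunction {n : ℕ} (φ : Space n → ℝ) : Prop where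
  smooth : ContDiff ℝ ∞ φ
  compact : HasCompactSupport φ

/-- `g` is the weak gradient of `f`: `∫ f ∇φ = - ∫ φ g` for all test functions `φ`. -/
def HasWeakGradient {n : ℕ} (f : L2 n) (g : L2Field n) : Prop :=
  ∀ φ : Space n → ℝ, IsTestFunction φ →
    ∫ x, f x • ∇ φ x = -∫ x, φ x • g x

theorem IsTestFunction.continuous_gradient {n : ℕ} {φ : Space n → ℝ} (h : IsTestFunction φ) :
    Continuous (∇ φ) :=
  (InnerProductSpace.toDual ℝ (Space n)).symm.continuous.comp
    (h.smooth.continuous_fderiv (by simp))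

theorem IsTestFunction.compact_gradient {n : ℕ} {φ : Space n → ℝ} (h : IsTestFunction φ) :
    HasCompactSupport (∇ φ) :=
  (h.compact.fderiv (𝕜 := ℝ)).comp_left (g := (InnerProductSpace.toDual ℝ (Space n)).symm)
    (map_zero _)

theorem integrable_smul_gradient {n : ℕ} (f : L2 n) {φ : Space n → ℝ} (h : IsTestFunction φ) :
    Integrable (fun x => f x • ∇ φ x) := by
  have h2 : MemLp (∇ φ) 2 (volume : Measure (Space n)) :=
    h.continuous_gradient.memLp_of_hasCompactSupport h.compact_gradient
  exact memLp_one_iff_integrable.1 (h2.smul (Lp.memLp f) (r := 1))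

theorem integrable_smul_field {n : ℕ} (g : L2Field n) {φ : Space n → ℝ} (h : IsTestFunction φ) :
    Integrable (fun x => φ x • g x) := by
  have h2 : MemLp φ 2 (volume : Measure (Space n)) :=
    h.smooth.continuous.memLp_of_hasCompactSupport h.compact
  exact memLp_one_iff_integrable.1 ((Lp.memLp g).smul h2 (r := 1))

/-- The Sobolev space `H¹(ℝⁿ)`, as the space of pairs `(f, ∇f)` with `f ∈ L²` and weak gradient
`∇f ∈ L²`; the inherited norm is `(‖f‖₂² + ‖∇f‖₂²)^{1/2}`. -/
noncomputable def H1 (n : ℕ) : Submodule ℝ (WithLp 2 (L2 n × L2Field n)) where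
  carrier := {w | HasWeakGradient w.fst w.snd}
  zero_mem' := by
    intro φ _
    have h1 : (fun x => ((0 : L2 n) : Space n → ℝ) x • ∇ φ x) =ᵐ[volume] 0 := by
      filter_upwards with x
      simp
    have h2 : (fun x => φ x • ((0 : L2Field n) : Space n → Space n) x) =ᵐ[volume] 0 := by
      filter_upwards with x
      simp
    change ∫ x, ((0 : L2 n) : Space n → ℝ) x • ∇ φ x
      = -∫ x, φ x • ((0 : L2Field n) : Space n → Space n) x
    rw [integral_congr_ae h1, integral_congr_ae h2]
    simp
  add_mem' := by
    intro a b ha hb φ hφ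
    have h1 : (fun x => (a.fst + b.fst : L2 n) x • ∇ φ x)
        =ᵐ[volume] fun x => a.fst x • ∇ φ x + b.fst x • ∇ φ x := by
      filter_upwards [Lp.coeFn_add a.fst b.fst] with x hx
      rw [hx, Pi.add_apply, add_smul]
    have h2 : (fun x => φ x • (a.snd + b.snd : L2Field n) x)
        =ᵐ[volume] fun x => φ x • a.snd x + φ x • b.snd x := by
      filter_upwards [Lp.coeFn_add a.snd b.snd] with x hx
      rw [hx, Pi.add_apply, smul_add]
    change ∫ x, (a.fst + b.fst : L2 n) x • ∇ φ x = -∫ x, φ x • (a.snd + b.snd : L2Field n) x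
    rw [integral_congr_ae h1, integral_congr_ae h2,
      integral_add (integrable_smul_gradient _ hφ) (integrable_smul_gradient _ hφ),
      integral_add (integrable_smul_field _ hφ) (integrable_smul_field _ hφ),
      ha φ hφ, hb φ hφ, neg_add]
  smul_mem' := by
    intro c a ha φ hφ
    have h1 : (fun x => (c • a.fst : L2 n) x • ∇ φ x)
        =ᵐ[volume] fun x => c • (a.fst x • ∇ φ x) := by
      filter_upwards [Lp.coeFn_smul c a.fst] with x hx
      rw [hx, Pi.smul_apply, smul_assoc]
    have h2 : (fun x => φ x • (c • a.snd : L2Field n) x)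
        =ᵐ[volume] fun x => c • (φ x • a.snd x) := by
      filter_upwards [Lp.coeFn_smul c a.snd] with x hx
      rw [hx, Pi.smul_apply, smul_comm]
    change ∫ x, (c • a.fst : L2 n) x • ∇ φ x = -∫ x, φ x • (c • a.snd : L2Field n) x
    rw [integral_congr_ae h1, integral_congr_ae h2, integral_smul, integral_smul, ha φ hφ, smul_neg]

/-- The inclusion `H¹(ℝⁿ) ⊆ L²(ℝⁿ)`. -/
noncomputable def H1.toL2 {n : ℕ} (w : H1 n) : L2 n := (w : WithLp 2 (L2 n × L2Field n)).fst

/-- `p` is the positive root of `(n - 1) p² - (n + 1) p - 2 = 0`. -/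
def IsCriticalExponent (n : ℕ) (p : ℝ) : Prop :=
  0 < p ∧ ((n : ℝ) - 1) * p ^ 2 - ((n : ℝ) + 1) * p - 2 = 0

/-- The time interval `[0, T)`, where `T = ∞` is allowed. -/
def timeInterval (T : EReal) : Set ℝ := {t | 0 ≤ t ∧ (t : EReal) < T}

/-- `(u, v) ∈ C([0, T), H¹ × L²)` with `v = u_t`, and `u` solves `Δu - u_tt + |u|^p = 0` on
`ℝⁿ × (0, T)` in the sense of distributions, with initial values `u(0) = u₀`, `u_t(0) = u₁`.
The values of `u` and `v` at times outside `[0, T)` play no role. -/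
structure IsSolution {n : ℕ} (p : ℝ) (u₀ : H1 n) (u₁ : L2 n) (T : EReal)
    (u : ℝ → H1 n) (v : ℝ → L2 n) : Prop where
  continuousOn : ContinuousOn (fun t => (u t, v t)) (timeInterval T)
  /-- `u_t = v`, with the derivative taken in `L²(ℝⁿ)`. -/
  hasDerivAt : ∀ t ∈ timeInterval T, 0 < t → HasDerivAt (fun s => H1.toL2 (u s)) (v t) t
  /-- `|u|^p` is a distribution. -/
  locallyIntegrable : ∀ t ∈ timeInterval T, LocallyIntegrable (fun x => |H1.toL2 (u t) x| ^ p)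
  /-- `d/dt ⟨u_t, φ⟩ = ⟨u, Δφ⟩ + ⟨|u|^p, φ⟩` for all test functions `φ`. -/
  equation : ∀ φ : Space n → ℝ, IsTestFunction φ → ∀ t ∈ timeInterval T, 0 < t →
    HasDerivAt (fun s => ∫ x, v s x * φ x)
      ((∫ x, H1.toL2 (u t) x * Δ φ x) + ∫ x, |H1.toL2 (u t) x| ^ p * φ x) t
  initial_position : u 0 = u₀
  initial_velocity : v 0 = u₁

/-- `supp (u, v) ⊆ {(x, t) : |x| ≤ t + R}`. -/
def SupportedInCone {n : ℕ} (R : ℝ) (T : EReal) (u : ℝ → H1 n) (v : ℝ → L2 n) : Prop :=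
  ∀ t ∈ timeInterval T, ∀ᵐ x : Space n, t + R < ‖x‖ → H1.toL2 (u t) x = 0 ∧ v t x = 0

end CriticalWave

/-! Suppose the solution is global and put κ = (n-1)/2, with q conjugate to p. An average over the
unit sphere of plane waves (1 + (t+R+1-x·w)²)^(-β/2) is a smooth solution G of the linear wave
equation. For β > 0 it is positive and decreasing in time on the cone |x| ≤ t+R. Hence the
`wronskian` W = ∫ (u_t G - u G_t) is positive at time 0, and W' = ∫ |u|^p G ≥ 0. Moreover the moment
M = ∫ uG satisfies M' = W + 2 ∫ u G_t, so an upper bound for ∫ uG and ∫ u G_t controls time averages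
of W.

That bound comes from Hölder. With T = t+R+1, the averaged waves decay like T^(-κ) (T-|x|)^(κ-β-1)
for G_t, and T times this for G (`exists_waveAvg_profile_le`). For β = κ + a/q - 1 the q-th power is
integrable up to the factor ∫_1^{CT} s^(-a) ds. At the critical exponent all powers of T balance,
leaving τ^(1/p) for times in [τ, 2τ] (`exists_moment_le`). The p-th power is always measured by S,
the source ∫ |u|^p G at β = κ - 1/p. After averaging over [τ, 2τ] (`average_le`) the factor τ^(1/p)
cancels: the averaged W is at most a constant times (∫ s^(-a))^(1/q) V(τ)^(1/p), where V(τ) is a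
weighted integral of S over [τ, 2τ].

Two values of a are used. For a = 2 the s-integral is bounded, and W ≥ W(0) > 0 gives a uniform
lower bound for V. For a = 1 the exponent β is κ - 1/p itself, so W is a primitive of S; the
s-integral is logarithmic, of size k+1 at τ = 2^k. With L = W - W(0) this gives L(2^k) ≲ (k+1)^(1/q)
V^(1/p) and V ≲ k+1, so L(2^k) grows at most linearly in k. The lower bound on V forces at least
linear growth; inserted into L^p ≲ (k+1)^(p-1) V it turns V ≲ L(2^(k+1)) - L(2^k) into geometric
growth, a contradiction (`false_of_growth`). -/

namespace CriticalWave

open Set Filter Topology Metric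
open scoped RealInnerProductSpace ENNReal

/-! ### Smooth dependence of integrals on a parameter -/

section ParametricIntegral

theorem integrable_of_continuous_of_ball {W E : Type} [NormedAddCommGroup W] [ProperSpace W]
    [SecondCountableTopology W] [MeasurableSpace W] [BorelSpace W] [NormedAddCommGroup E] {μ : Measure W} [IsFiniteMeasure μ]
    (hμ : ∀ᵐ w ∂μ, w ∈ closedBall (0 : W) 1) {f : W → E} (hf : Continuous f) :
    Integrable f μ := by
  obtain ⟨C, hC⟩ := (isCompact_closedBall (0 : W) 1).exists_bound_of_continuousOn hf.continuousOn
  exact Integrable.of_bound hf.aestronglyMeasurable C (hμ.mono fun w hw => hC w hw)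

variable {X W E : Type} [NormedAddCommGroup X] [NormedSpace ℝ X] [ProperSpace X]
  [NormedAddCommGroup W] [NormedSpace ℝ W] [ProperSpace W] [SecondCountableTopology W]
  [MeasurableSpace W] [BorelSpace W]
  [NormedAddCommGroup E] [NormedSpace ℝ E]

theorem hasFDerivAt_integral_of_contDiff {μ : Measure W} [IsFiniteMeasure μ]
    (hμ : ∀ᵐ w ∂μ, w ∈ closedBall (0 : W) 1) {f : X × W → E} (hf : ContDiff ℝ 1 f) (x : X) :
    HasFDerivAt (fun x => ∫ w, f (x, w) ∂μ)
      (∫ w, (fderiv ℝ f (x, w)).comp (ContinuousLinearMap.inl ℝ X W) ∂μ) x := by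
  have hc : Continuous fun z : X × W =>
      (fderiv ℝ f z).comp (ContinuousLinearMap.inl ℝ X W) :=
    (hf.continuous_fderiv (by simp)).clm_comp continuous_const
  obtain ⟨C, hC⟩ := ((isCompact_closedBall x 1).prod
    (isCompact_closedBall (0 : W) 1)).exists_bound_of_continuousOn hc.continuousOn
  refine hasFDerivAt_integral_of_dominated_of_fderiv_le (bound := fun _ => C)
    (F' := fun x w => (fderiv ℝ f (x, w)).comp (ContinuousLinearMap.inl ℝ X W))
    (closedBall_mem_nhds x one_pos) ?_ ?_ ?_ ?_ (integrable_const C) ?_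
  · exact Eventually.of_forall fun y =>
      (hf.continuous.comp (by fun_prop : Continuous fun w : W => (y, w))).aestronglyMeasurable
  · exact integrable_of_continuous_of_ball hμ
      (hf.continuous.comp (by fun_prop : Continuous fun w : W => (x, w)))
  · exact (hc.comp (by fun_prop : Continuous fun w : W => (x, w))).aestronglyMeasurable
  · exact hμ.mono fun w hw y hy => hC (y, w) ⟨hy, hw⟩
  · refine Eventually.of_forall fun w y _ => ?_
    exact ((hf.differentiable (by simp)) (y, w)).hasFDerivAt.comp y
      (hasFDerivAt_prodMk_left y w)

/-- The derivative is an integral of the same kind with values in continuous linear maps, so the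
induction on the order of smoothness must let the codomain vary. -/
theorem contDiff_integral {μ : Measure W} [IsFiniteMeasure μ]
    (hμ : ∀ᵐ w ∂μ, w ∈ closedBall (0 : W) 1) {f : X × W → E} (hf : ContDiff ℝ ∞ f) :
    ContDiff ℝ ∞ fun x => ∫ w, f (x, w) ∂μ := by
  rw [contDiff_infty]
  intro k
  induction k generalizing E with
  | zero =>
    refine contDiff_zero.2 (Differentiable.continuous (𝕜 := ℝ) fun x => ?_)
    exact (hasFDerivAt_integral_of_contDiff hμ (hf.of_le (mod_cast le_top)) x).differentiableAt
  | succ k ih =>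
    have hf1 : ContDiff ℝ 1 f := hf.of_le (mod_cast le_top)
    have hd := hasFDerivAt_integral_of_contDiff hμ hf1
    push_cast
    refine contDiff_succ_iff_fderiv.2 ⟨fun x => (hd x).differentiableAt, by simp, ?_⟩
    rw [show fderiv ℝ (fun x => ∫ w, f (x, w) ∂μ) = _ from funext fun x => (hd x).fderiv]
    exact ih (f := fun z => (fderiv ℝ f z).comp (ContinuousLinearMap.inl ℝ X W))
      ((hf.fderiv_right (by simp)).clm_comp contDiff_const)

end ParametricIntegral

/-! ### Superpositions of plane waves -/

variable {n : ℕ}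

/-- The superposition `∫ h (t - ⟪x, w⟫) dμ(w)` of plane waves with profile `h`. -/
noncomputable def waveAvg (μ : Measure (Space n)) (h : ℝ → ℝ) (t : ℝ) (x : Space n) : ℝ :=
  ∫ w, h (t - ⟪x, w⟫) ∂μ

section WaveAvg

variable {μ : Measure (Space n)} [IsFiniteMeasure μ]

theorem contDiff_waveAvg (hμ : ∀ᵐ w ∂μ, w ∈ closedBall (0 : Space n) 1) {h : ℝ → ℝ}
    (hh : ContDiff ℝ ∞ h) : ContDiff ℝ ∞ fun z : ℝ × Space n => waveAvg μ h z.1 z.2 :=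
  contDiff_integral (f := fun z : (ℝ × Space n) × Space n => h (z.1.1 - ⟪z.1.2, z.2⟫)) hμ
    (hh.comp ((contDiff_fst.fst).sub (contDiff_fst.snd.inner ℝ contDiff_snd)))

theorem hasFDerivAt_planeWave {h : ℝ → ℝ} (hh : ContDiff ℝ ∞ h) (t : ℝ) (x w : Space n) :
    HasFDerivAt (fun x : Space n => h (t - ⟪x, w⟫)) (-(deriv h (t - ⟪x, w⟫)) • innerSL ℝ w) x := by
  have h1 : HasDerivAt h (deriv h (t - ⟪x, w⟫)) (t - ⟪x, w⟫) :=
    (hh.differentiable (by simp) _).hasDerivAt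
  have h2 : HasFDerivAt (fun x : Space n => t - ⟪x, w⟫) (-(innerSL ℝ w)) x := by
    have := ((innerSL ℝ w).hasFDerivAt (x := x)).const_sub t
    refine this.congr_of_eventuallyEq (Eventually.of_forall fun y => ?_)
    simp [real_inner_comm]
  have := h1.comp_hasFDerivAt x h2
  rwa [smul_neg, ← neg_smul] at this

theorem hasDerivAt_waveAvg (hμ : ∀ᵐ w ∂μ, w ∈ closedBall (0 : Space n) 1) {h : ℝ → ℝ}
    (hh : ContDiff ℝ ∞ h) (t : ℝ) (x : Space n) :
    HasDerivAt (fun s => waveAvg μ h s x) (waveAvg μ (deriv h) t x) t := by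
  have hf : ContDiff ℝ ∞ (fun z : ℝ × Space n => h (z.1 - ⟪x, z.2⟫)) :=
    hh.comp (contDiff_fst.sub (contDiff_const.inner ℝ contDiff_snd))
  have hd := (hasFDerivAt_integral_of_contDiff hμ (hf.of_le (by simp)) t).hasDerivAt
  have hc : Continuous fun z : ℝ × Space n =>
      (fderiv ℝ (fun z : ℝ × Space n => h (z.1 - ⟪x, z.2⟫)) z).comp
        (ContinuousLinearMap.inl ℝ ℝ (Space n)) :=
    (hf.continuous_fderiv (by simp)).clm_comp continuous_const
  have hi := integrable_of_continuous_of_ball hμ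
    (hc.comp (by fun_prop : Continuous fun w : Space n => (t, w)))
  rw [ContinuousLinearMap.integral_apply (by exact hi)] at hd
  refine hd.congr_deriv (integral_congr_ae (Eventually.of_forall fun w => ?_))
  symm
  have h1 : HasDerivAt (fun s => h (s - ⟪x, w⟫)) (deriv h (t - ⟪x, w⟫)) t := by
    simpa using (hh.differentiable (by simp) (t - ⟪x, w⟫)).hasDerivAt.comp_sub_const t _
  have h2 := ((hf.differentiable (by simp) (t, w)).hasFDerivAt.comp t
    (hasFDerivAt_prodMk_left (𝕜 := ℝ) t w)).hasDerivAt
  exact h1.unique h2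

theorem fderiv_waveAvg_apply (hμ : ∀ᵐ w ∂μ, w ∈ closedBall (0 : Space n) 1) (e : Space n)
    {f : Space n × Space n → ℝ} (hf : ContDiff ℝ ∞ f) {f' : Space n → Space n → ℝ} (x : Space n)
    (hf' : ∀ w, HasFDerivAt (fun x => f (x, w)) ((f' x w) • innerSL ℝ w) x) :
    fderiv ℝ (fun x => ∫ w, f (x, w) ∂μ) x e = ∫ w, f' x w * ⟪w, e⟫ ∂μ := by
  have hc : Continuous fun z : Space n × Space n => (fderiv ℝ f z).comp
        (ContinuousLinearMap.inl ℝ (Space n) (Space n)) :=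
    (hf.continuous_fderiv (by simp)).clm_comp continuous_const
  have hi := integrable_of_continuous_of_ball hμ
    (hc.comp (by fun_prop : Continuous fun w : Space n => (x, w)))
  rw [(hasFDerivAt_integral_of_contDiff hμ (hf.of_le (by simp)) x).fderiv,
    ContinuousLinearMap.integral_apply (by exact hi)]
  refine integral_congr_ae (Eventually.of_forall fun w => ?_)
  have h2 := (hf.differentiable (by simp) (x, w)).hasFDerivAt.comp x
    (hasFDerivAt_prodMk_left (𝕜 := ℝ) x w)
  simpa using congrArg (fun l => l e) (h2.unique (hf' w))

theorem contDiff_deriv {h : ℝ → ℝ} (hh : ContDiff ℝ ∞ h) : ContDiff ℝ ∞ (deriv h) :=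
  (contDiff_infty_iff_deriv.1 hh).2

/-- Differentiating twice along the i-th basis vector produces the factor w_i², and these sum to
‖w‖² = 1. Since two time derivatives also produce h'', the average solves the wave equation. -/
theorem laplacian_waveAvg (hμ : ∀ᵐ w ∂μ, ‖w‖ = 1) {h : ℝ → ℝ}
    (hh : ContDiff ℝ ∞ h) (t : ℝ) (x : Space n) :
    Δ (waveAvg μ h t) x = waveAvg μ (deriv (deriv h)) t x := by
  have hμ' : ∀ᵐ w ∂μ, w ∈ closedBall (0 : Space n) 1 := hμ.mono fun w hw => by simp [hw]
  have hG : ContDiff ℝ ∞ (waveAvg μ h t) := 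
    (contDiff_waveAvg hμ' hh).comp (contDiff_const.prodMk contDiff_id)
  have hh' := contDiff_deriv hh
  have hh'' := contDiff_deriv hh'
  set b := EuclideanSpace.basisFun (Fin n) ℝ
  rw [InnerProductSpace.laplacian_eq_iteratedFDeriv_orthonormalBasis _ b]
  have key : ∀ i, iteratedFDeriv ℝ 2 (waveAvg μ h t) x ![b i, b i]
      = ∫ w, deriv (deriv h) (t - ⟪x, w⟫) * ⟪w, b i⟫ ^ 2 ∂μ := by
    intro i
    rw [iteratedFDeriv_two_apply]
    have h1 : ∀ y, fderiv ℝ (waveAvg μ h t) y (b i)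
        = ∫ w, (fun z : Space n × Space n => -deriv h (t - ⟪z.1, z.2⟫) * ⟪z.2, b i⟫) (y, w) ∂μ :=
      fun y => fderiv_waveAvg_apply hμ' (b i)
        (f := fun z : Space n × Space n => h (t - ⟪z.1, z.2⟫))
        (hh.comp (contDiff_const.sub (contDiff_fst.inner ℝ contDiff_snd)))
        (f' := fun y w => -deriv h (t - ⟪y, w⟫)) y (fun w => hasFDerivAt_planeWave hh t y w)
    have h2 : fderiv ℝ (fderiv ℝ (waveAvg μ h t)) x (b i) (b i)
        = fderiv ℝ (fun y => fderiv ℝ (waveAvg μ h t) y (b i)) x (b i) := by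
      have hd : DifferentiableAt ℝ (fderiv ℝ (waveAvg μ h t)) x :=
        (hG.fderiv_right (m := ∞) (by simp)).differentiable (by simp) x
      rw [fderiv_clm_apply hd (differentiableAt_const _)]
      simp
    simp only [Matrix.cons_val_zero, Matrix.cons_val_one]
    rw [h2, funext h1]
    rw [fderiv_waveAvg_apply hμ' (b i)
      (f := fun z : Space n × Space n => -deriv h (t - ⟪z.1, z.2⟫) * ⟪z.2, b i⟫)
      (f' := fun y w => deriv (deriv h) (t - ⟪y, w⟫) * ⟪w, b i⟫)]
    · exact integral_congr_ae (Eventually.of_forall fun w => by simp; ring)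
    · refine ContDiff.mul (ContDiff.neg (hh'.comp
        (contDiff_const.sub (contDiff_fst.inner ℝ contDiff_snd))))
        (contDiff_snd.inner ℝ contDiff_const)
    · intro w
      have := ((hasFDerivAt_planeWave hh' t x w).neg).mul_const ⟪w, b i⟫
      refine this.congr_fderiv ?_
      rw [neg_smul, neg_neg, smul_smul, mul_comm]
  simp only [key]
  rw [← integral_finsetSum]
  · refine integral_congr_ae (hμ.mono fun w hw => ?_)
    simp only
    rw [← Finset.mul_sum]
    have : ∑ i, ⟪w, b i⟫ ^ 2 = ‖w‖ ^ 2 := by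
      rw [← b.sum_sq_norm_inner_right w]
      exact Finset.sum_congr rfl fun i _ => by rw [real_inner_comm, Real.norm_eq_abs, sq_abs]
    rw [this, hw]
    simp
  · intro i _
    refine integrable_of_continuous_of_ball hμ' ?_
    exact (hh''.continuous.comp (by fun_prop)).mul (by fun_prop)

end WaveAvg

/-! ### Spherical caps and decay of averaged plane waves -/

/-- A rotation invariant finite measure on the unit sphere of `ℝⁿ`. -/
noncomputable def sphereMeasure (n : ℕ) : Measure (Space n) :=
  (volume.restrict (ball 0 1)).map fun y => ‖y‖⁻¹ • y

theorem measurable_normalize : Measurable fun y : Space n => ‖y‖⁻¹ • y := by fun_prop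

instance : IsFiniteMeasure (sphereMeasure n) := by
  have : IsFiniteMeasure ((volume : Measure (Space n)).restrict (ball 0 1)) :=
    ⟨by rw [Measure.restrict_apply_univ]; exact measure_ball_lt_top⟩
  exact Measure.isFiniteMeasure_map _ _

theorem sphereMeasure_univ_ne_zero : sphereMeasure n univ ≠ 0 := by
  rw [sphereMeasure, Measure.map_apply measurable_normalize MeasurableSet.univ, preimage_univ,
    Measure.restrict_apply_univ]
  exact (measure_ball_pos _ _ one_pos).ne'

theorem ae_norm_eq_one_sphereMeasure (hn : n ≠ 0) : ∀ᵐ w ∂(sphereMeasure n), ‖w‖ = 1 := by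
  have : NeZero n := ⟨hn⟩
  rw [sphereMeasure, ae_map_iff measurable_normalize.aemeasurable
    (measurableSet_eq_fun measurable_norm measurable_const)]
  have : ∀ᵐ y : Space n, y ≠ 0 := Measure.ae_ne volume 0
  filter_upwards [ae_restrict_of_ae this] with y hy
  rw [norm_smul, norm_inv, norm_norm, inv_mul_cancel₀ (norm_ne_zero_iff.2 hy)]

theorem volume_box_le (b : OrthonormalBasis (Fin n) ℝ (Space n)) (c : Fin n → ℝ) :
    volume {y : Space n | ∀ i, b.repr y i ∈ Icc (-c i) (c i)}
      = ∏ i, ENNReal.ofReal (2 * c i) := by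
  have hm : MeasurableSet (Set.pi univ fun i => Icc (-c i) (c i)) :=
    MeasurableSet.univ_pi fun i => measurableSet_Icc
  have h1 := (EuclideanSpace.volume_preserving_symm_measurableEquiv_toLp (Fin n)).comp
    b.measurePreserving_repr
  have h2 := h1.measure_preimage hm.nullMeasurableSet
  rw [pi_univ_Icc, Real.volume_Icc_pi] at h2
  simp only [sub_neg_eq_add, ← two_mul] at h2
  rw [← h2, ← pi_univ_Icc]
  congr 1
  ext y
  simp [Pi.le_def, forall_and]

/-- The cone in the unit ball over the cap fits into a box with half-side 1 along e and √(2δ) in the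
n-1 orthogonal directions, because |y|² - ⟪e,y⟫² = (|y| - ⟪e,y⟫)(|y| + ⟪e,y⟫) ≤ δ|y| · 2|y|. -/
theorem sphereMeasure_cap_le (hn : n ≠ 0) {e : Space n} (he : ‖e‖ = 1) {δ : ℝ} (hδ : 0 ≤ δ) :
    sphereMeasure n {w | 1 - ⟪e, w⟫ ≤ δ}
      ≤ ENNReal.ofReal (2 * (2 * √2) ^ (n - 1) * δ ^ (((n : ℝ) - 1) / 2)) := by
  have i0 : Fin n := ⟨0, Nat.pos_of_ne_zero hn⟩
  obtain ⟨b, hb⟩ := Orthonormal.exists_orthonormalBasis_extension_of_card_eq (𝕜 := ℝ)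
    (E := Space n) (ι := Fin n) (by simp) (v := fun _ => e) (s := {i0})
    (by
      rw [orthonormal_iff_ite]
      rintro ⟨i, hi⟩ ⟨j, hj⟩
      simp only [mem_singleton_iff] at hi hj
      subst hi; subst hj
      simp [he])
  have hb0 : b i0 = e := hb i0 rfl
  set c : Fin n → ℝ := fun i => if i = i0 then 1 else √(2 * δ)
  have hms : MeasurableSet {w : Space n | 1 - ⟪e, w⟫ ≤ δ} :=
    measurableSet_le (by fun_prop) measurable_const
  rw [sphereMeasure, Measure.map_apply measurable_normalize hms,
    Measure.restrict_apply (measurable_normalize hms)]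
  calc volume ((fun y : Space n => ‖y‖⁻¹ • y) ⁻¹' {w | 1 - ⟪e, w⟫ ≤ δ} ∩ ball 0 1)
      ≤ volume {y : Space n | ∀ i, b.repr y i ∈ Icc (-c i) (c i)} := by
        refine measure_mono ?_
        rintro y ⟨hy1, hy2⟩ i
        rw [mem_ball_zero_iff] at hy2
        rw [mem_preimage, mem_ofPred_eq, inner_smul_right] at hy1
        rw [mem_Icc, ← abs_le]
        have hsum : ∑ j, (b.repr y j) ^ 2 = ‖y‖ ^ 2 := by
          rw [← b.repr.norm_map y, EuclideanSpace.norm_sq_eq]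
          simp
        have hy0 : b.repr y i0 = ⟪e, y⟫ := by rw [b.repr_apply_apply, hb0]
        by_cases hi : i = i0
        · simp only [c, hi, if_true, hy0]
          refine (abs_real_inner_le_norm e y).trans ?_
          rw [he, one_mul]
          exact hy2.le
        · simp only [c, hi, if_false]
          refine Real.abs_le_sqrt ?_
          have h2 : (b.repr y i) ^ 2 + (b.repr y i0) ^ 2 ≤ ‖y‖ ^ 2 := by
            rw [← hsum, ← Finset.sum_pair (f := fun j => (b.repr y j) ^ 2) hi]
            exact Finset.sum_le_sum_of_subset_of_nonneg (Finset.subset_univ _)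
              fun _ _ _ => sq_nonneg _
          rcases eq_or_ne y 0 with rfl | hne
          · simp; positivity
          have hpos : 0 < ‖y‖ := norm_pos_iff.2 hne
          have h3 : ‖y‖ - ⟪e, y⟫ ≤ δ * ‖y‖ := by
            have := mul_le_mul_of_nonneg_right hy1 hpos.le
            rwa [sub_mul, one_mul, mul_right_comm, inv_mul_cancel₀ hpos.ne', one_mul] at this
          have h4 : ⟪e, y⟫ ≤ ‖y‖ := by
            simpa [he] using real_inner_le_norm e y
          rw [hy0] at h2
          nlinarith [norm_nonneg y, abs_real_inner_le_norm e y, neg_abs_le ⟪e, y⟫,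
            mul_nonneg hδ hpos.le]
    _ = ∏ i, ENNReal.ofReal (2 * c i) := volume_box_le b c
    _ ≤ _ := by
        have hc : ∀ i, 0 ≤ c i := fun i => by
          simp only [c]; split_ifs <;> positivity
        rw [← ENNReal.ofReal_prod_of_nonneg fun i _ => by have := hc i; positivity]
        refine ENNReal.ofReal_le_ofReal (le_of_eq ?_)
        rw [← Finset.mul_prod_erase _ _ (Finset.mem_univ i0)]
        have : ∏ i ∈ Finset.univ.erase i0, 2 * c i = (2 * √(2 * δ)) ^ (n - 1) := by
          rw [Finset.prod_congr rfl (g := fun _ => 2 * √(2 * δ)), Finset.prod_const,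
            Finset.card_erase_of_mem (Finset.mem_univ _), Finset.card_univ, Fintype.card_fin]
          intro i hi
          simp [c, Finset.ne_of_mem_erase hi]
        rw [this]
        have h5 : √δ ^ (n - 1) = δ ^ (((n : ℝ) - 1) / 2) := by
          rw [Real.sqrt_eq_rpow, ← Real.rpow_natCast, ← Real.rpow_mul hδ,
            Nat.cast_sub (Nat.one_le_iff_ne_zero.2 hn)]
          congr 1
          push_cast
          ring
        rw [← h5, Real.sqrt_mul (by norm_num)]
        simp only [c, if_true]
        ring

/-- Layer-cake argument: s^(-γ) = γ ∫_s^∞ z^(-γ-1) dz, and after Fubini the set where the phase τ -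
⟪x,w⟫ is below z lies in a cap of height z/‖x‖. The remaining integral over z > τ - ‖x‖ converges
because κ < γ. -/
theorem lintegral_planeWave_le {μ : Measure (Space n)} [SFinite μ] {A κ γ : ℝ} (hA : 0 ≤ A)
    (hγ : κ < γ) (hγ0 : 0 < γ)
    (hcap : ∀ e : Space n, ‖e‖ = 1 → ∀ δ, 0 ≤ δ →
      μ {w | 1 - ⟪e, w⟫ ≤ δ} ≤ ENNReal.ofReal (A * δ ^ κ))
    (hμ : ∀ᵐ w ∂μ, ‖w‖ = 1)
    {τ : ℝ} {x : Space n} (hx0 : 0 < ‖x‖) (hx : ‖x‖ < τ) :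
    ∫⁻ w, ENNReal.ofReal ((τ - ⟪x, w⟫) ^ (-γ)) ∂μ
      ≤ ENNReal.ofReal (γ * A / (γ - κ) * ‖x‖ ^ (-κ) * (τ - ‖x‖) ^ (κ - γ)) := by
  set D := τ - ‖x‖ with hD
  have hD0 : 0 < D := sub_pos.2 hx
  set s : Space n → ℝ := fun w => τ - ⟪x, w⟫ with hs
  have hsm : Measurable s := by simp only [hs]; fun_prop
  have hsD : ∀ᵐ w ∂μ, D ≤ s w := hμ.mono fun w hw => by
    have := real_inner_le_norm x w
    rw [hw, mul_one] at this
    simp only [hs, hD]; linarith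
  set F : ℝ → ℝ≥0∞ := fun z => ENNReal.ofReal (γ * z ^ (-γ - 1)) with hF
  have hFm : Measurable F := by simp only [hF]; fun_prop
  have tail : ∀ {a c : ℝ}, 0 < a → 0 < c →
      ∫⁻ z in Ioi c, ENNReal.ofReal (z ^ (-a - 1)) = ENNReal.ofReal (c ^ (-a) / a) := by
    intro a c ha hc
    rw [← ofReal_integral_eq_lintegral_ofReal (integrableOn_Ioi_rpow_of_lt (by linarith) hc)
      ((ae_restrict_mem measurableSet_Ioi).mono fun z hz =>
        Real.rpow_nonneg (hc.trans hz).le _), integral_Ioi_rpow_of_lt (by linarith) hc]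
    congr 1
    rw [show -a - 1 + 1 = -a by ring, neg_div_neg_eq]
  have h1 : ∫⁻ w, ENNReal.ofReal ((s w) ^ (-γ)) ∂μ
      = ∫⁻ w, ∫⁻ z in Ioi D, {q : Space n × ℝ | s q.1 < q.2}.indicator (fun q => F q.2)
          (w, z) ∂volume ∂μ := by
    refine lintegral_congr_ae (hsD.mono fun w hw => ?_)
    have : ∀ z, {q : Space n × ℝ | s q.1 < q.2}.indicator (fun q => F q.2) (w, z)
        = (Ioi (s w)).indicator F z := fun z => by simp [indicator]
    simp only [this]
    rw [lintegral_indicator measurableSet_Ioi, Measure.restrict_restrict measurableSet_Ioi,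
      inter_eq_left.2 (Ioi_subset_Ioi hw)]
    simp only [hF, ENNReal.ofReal_mul hγ0.le]
    rw [lintegral_const_mul _ (by fun_prop), tail hγ0 (hD0.trans_le hw),
      ← ENNReal.ofReal_mul hγ0.le]
    congr 1
    field_simp
  rw [h1, lintegral_lintegral_swap]
  · calc ∫⁻ z in Ioi D, ∫⁻ w, {q : Space n × ℝ | s q.1 < q.2}.indicator (fun q => F q.2) (w, z) ∂μ
        ≤ ∫⁻ z in Ioi D, ENNReal.ofReal (γ * A * ‖x‖ ^ (-κ)) *
            ENNReal.ofReal (z ^ (-(γ - κ) - 1)) := by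
          refine setLIntegral_mono (by fun_prop) fun z hz => ?_
          have hz0 : 0 < z := hD0.trans hz
          have : ∀ w, {q : Space n × ℝ | s q.1 < q.2}.indicator (fun q => F q.2) (w, z)
              = {w | s w < z}.indicator (fun _ => F z) w := fun w => by simp [indicator]
          simp only [this]
          rw [lintegral_indicator_const (measurableSet_lt hsm measurable_const)]
          have hsub : {w | s w < z} ⊆ {w | 1 - ⟪‖x‖⁻¹ • x, w⟫ ≤ z / ‖x‖} := by
            intro w hw
            simp only [hs, mem_ofPred_eq] at hw ⊢
            rw [le_div_iff₀ hx0, inner_smul_left]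
            simp only [map_inv₀, conj_trivial]
            rw [sub_mul, mul_right_comm, inv_mul_cancel₀ hx0.ne']
            linarith
          have hne : ‖‖x‖⁻¹ • x‖ = 1 := by
            rw [norm_smul, norm_inv, norm_norm, inv_mul_cancel₀ hx0.ne']
          calc F z * μ {w | s w < z} ≤ F z * ENNReal.ofReal (A * (z / ‖x‖) ^ κ) := by
                gcongr
                exact (measure_mono hsub).trans (hcap _ hne _ (by positivity))
            _ = _ := by
                simp only [hF]
                rw [← ENNReal.ofReal_mul (by positivity), ← ENNReal.ofReal_mul (by positivity)]
                congr 1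
                rw [Real.div_rpow hz0.le hx0.le, Real.rpow_neg hx0.le,
                  show -(γ - κ) - 1 = (-γ - 1) + κ by ring, Real.rpow_add hz0]
                ring
      _ = _ := by
          rw [lintegral_const_mul _ (by fun_prop), tail (sub_pos.2 hγ) hD0,
            ← ENNReal.ofReal_mul (by positivity)]
          congr 1
          rw [neg_sub]
          ring
  · refine Measurable.aemeasurable ?_
    exact (hFm.comp measurable_snd).indicator
      (measurableSet_lt (hsm.comp measurable_fst) measurable_snd)

/-- Decay of the average of the plane waves `(τ - ⟪x, w⟫) ^ (-γ)`. -/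
theorem exists_waveAvg_rpow_le (hn : n ≠ 0) {γ : ℝ} (hγ : ((n : ℝ) - 1) / 2 < γ) (hγ0 : 0 < γ) :
    ∃ C : ℝ, 0 < C ∧ ∀ (τ : ℝ) (x : Space n), ‖x‖ < τ →
      waveAvg (sphereMeasure n) (fun s => s ^ (-γ)) τ x
        ≤ C * (τ ^ (-(((n : ℝ) - 1) / 2)) * (τ - ‖x‖) ^ (((n : ℝ) - 1) / 2 - γ)) := by
  set κ := ((n : ℝ) - 1) / 2 with hκ
  have hκ0 : 0 ≤ κ := by
    have : (1 : ℝ) ≤ n := by exact_mod_cast Nat.one_le_iff_ne_zero.2 hn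
    rw [hκ]; linarith
  set μ := sphereMeasure n
  have hμ : ∀ᵐ w ∂μ, ‖w‖ = 1 := ae_norm_eq_one_sphereMeasure hn
  set A : ℝ := 2 * (2 * √2) ^ (n - 1)
  have hA : 0 ≤ A := by positivity
  have hγκ := sub_pos.2 hγ
  set C₁ := γ * A / (γ - κ) * 2 ^ κ
  set C₂ := 2 ^ γ * μ.real univ
  have hC₁ : 0 ≤ C₁ := by positivity
  have hC₂ : 0 ≤ C₂ := by positivity
  refine ⟨C₁ + C₂ + 1, by positivity, fun τ x hx => ?_⟩
  have hτ : 0 < τ := (norm_nonneg x).trans_lt hx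
  have hD : 0 < τ - ‖x‖ := sub_pos.2 hx
  have hsD : ∀ᵐ w ∂μ, τ - ‖x‖ ≤ τ - ⟪x, w⟫ := hμ.mono fun w hw => by
    have := real_inner_le_norm x w
    rw [hw, mul_one] at this
    linarith
  have hnn : 0 ≤ᵐ[μ] fun w => (τ - ⟪x, w⟫) ^ (-γ) :=
    hsD.mono fun w hw => Real.rpow_nonneg (hD.le.trans hw) _
  set P := τ ^ (-κ) * (τ - ‖x‖) ^ (κ - γ) with hP
  have hP0 : 0 ≤ P := by positivity
  suffices h : waveAvg μ (fun s => s ^ (-γ)) τ x ≤ (C₁ + C₂) * P by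
    refine h.trans ?_
    rw [add_mul _ 1]
    linarith
  -- Near the cone ‖x‖ is comparable to τ, and the cap estimate applies. Away from it the phase is
  -- at least τ/2 in every direction, and a pointwise bound suffices.
  rcases le_or_gt (τ / 2) ‖x‖ with hc | hc
  · have hx0 : 0 < ‖x‖ := (half_pos hτ).trans_le hc
    have h := lintegral_planeWave_le (μ := μ) hA hγ hγ0
      (fun e he δ hδ => sphereMeasure_cap_le hn he hδ) hμ hx0 hx
    rw [waveAvg, integral_eq_lintegral_of_nonneg_ae hnn
      (Measurable.aestronglyMeasurable (by fun_prop))]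
    refine (ENNReal.toReal_le_of_le_ofReal (by positivity) h).trans ?_
    have h2 : ‖x‖ ^ (-κ) ≤ 2 ^ κ * τ ^ (-κ) := by
      calc ‖x‖ ^ (-κ) ≤ (τ / 2) ^ (-κ) :=
            Real.rpow_le_rpow_of_nonpos (half_pos hτ) hc (by linarith)
        _ = _ := by
            rw [Real.div_rpow hτ.le (by norm_num), Real.rpow_neg zero_le_two, div_inv_eq_mul,
              mul_comm]
    calc γ * A / (γ - κ) * ‖x‖ ^ (-κ) * (τ - ‖x‖) ^ (κ - γ)
        ≤ γ * A / (γ - κ) * (2 ^ κ * τ ^ (-κ)) * (τ - ‖x‖) ^ (κ - γ) := by gcongr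
      _ = C₁ * P := by simp only [C₁, hP]; ring
      _ ≤ _ := by rw [add_mul]; have := mul_nonneg hC₂ hP0; linarith
  · have hb : ∀ᵐ w ∂μ, (τ - ⟪x, w⟫) ^ (-γ) ≤ (τ / 2) ^ (-γ) := hsD.mono fun w hw =>
      Real.rpow_le_rpow_of_nonpos (half_pos hτ) (by linarith) (by linarith)
    have h := integral_mono_of_nonneg hnn (integrable_const _) hb
    rw [integral_const, smul_eq_mul] at h
    refine h.trans ?_
    have h3 : τ ^ (κ - γ) ≤ (τ - ‖x‖) ^ (κ - γ) :=
      Real.rpow_le_rpow_of_nonpos hD (by linarith [norm_nonneg x]) (by linarith)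
    calc μ.real univ * (τ / 2) ^ (-γ) = C₂ * (τ ^ (-κ) * τ ^ (κ - γ)) := by
          rw [← Real.rpow_add hτ, Real.div_rpow hτ.le (by norm_num), Real.rpow_neg zero_le_two,
            div_inv_eq_mul]
          simp only [C₂]
          rw [show -κ + (κ - γ) = -γ by ring]
          ring
      _ ≤ C₂ * P := by rw [hP]; gcongr
      _ ≤ _ := by rw [add_mul]; have := mul_nonneg hC₁ hP0; linarith

/-! ### The profile and its spherical averages -/

/-- The wave profile `(1 + s²) ^ (-β / 2)`. -/
noncomputable def profile (β s : ℝ) : ℝ := (1 + s ^ 2) ^ (-β / 2)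

theorem contDiff_profile (β : ℝ) : ContDiff ℝ ∞ (profile β) :=
  ContDiff.rpow_const_of_ne (by fun_prop) fun s => by positivity

theorem profile_pos (β s : ℝ) : 0 < profile β s := by unfold profile; positivity

theorem deriv_profile (β s : ℝ) : deriv (profile β) s = -(β * (s * (1 + s ^ 2) ^ (-β / 2 - 1))) := by
  have h : HasDerivAt (fun s : ℝ => 1 + s ^ 2) (2 * s) s := by
    simpa using (hasDerivAt_pow 2 s).const_add 1
  have := h.rpow_const (p := -β / 2) (Or.inl (by positivity))
  rw [show profile β = fun s => (1 + s ^ 2) ^ (-β / 2) from rfl, this.deriv]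
  ring

theorem deriv_profile_neg {β s : ℝ} (hβ : 0 < β) (hs : 0 < s) : deriv (profile β) s < 0 := by
  rw [deriv_profile, neg_lt_zero]; positivity

theorem one_add_sq_rpow_le {a s : ℝ} (ha : 0 ≤ a) (hs : 0 < s) :
    (1 + s ^ 2) ^ (-a / 2) ≤ s ^ (-a) := by
  calc (1 + s ^ 2) ^ (-a / 2) ≤ (s ^ 2) ^ (-a / 2) :=
        Real.rpow_le_rpow_of_nonpos (by positivity) (by linarith) (by linarith)
    _ = s ^ (-a) := by
        rw [← Real.rpow_natCast, ← Real.rpow_mul hs.le]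
        congr 1
        push_cast
        ring

/-- The factor s is split off because the plane-wave estimate needs an exponent above (n-1)/2. The
main exponent β = (n-1)/2 - 1/p lies below it, while β + 1 is admissible; the factor s costs only 2T
in the cone. -/
theorem profile_le {β s : ℝ} (hβ : 0 ≤ β) (hs : 0 < s) : profile β s ≤ s * s ^ (-(β + 1)) := by
  refine (one_add_sq_rpow_le hβ hs).trans (le_of_eq ?_)
  nth_rewrite 2 [← Real.rpow_one s]
  rw [← Real.rpow_add hs]
  congr 1
  ring

theorem abs_deriv_profile_le {β s : ℝ} (hβ : 0 ≤ β) (hs : 0 < s) :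
    |deriv (profile β) s| ≤ β * s ^ (-(β + 1)) := by
  rw [deriv_profile, abs_neg, abs_of_nonneg (by positivity)]
  refine mul_le_mul_of_nonneg_left ?_ hβ
  have h := one_add_sq_rpow_le (a := β + 2) (by linarith) hs
  rw [show -(β + 2) / 2 = -β / 2 - 1 by ring] at h
  refine (mul_le_mul_of_nonneg_left h hs.le).trans (le_of_eq ?_)
  nth_rewrite 1 [← Real.rpow_one s]
  rw [← Real.rpow_add hs]
  congr 1
  ring

theorem ae_sub_inner_mem (hn : n ≠ 0) (T : ℝ) (x : Space n) :
    ∀ᵐ w ∂(sphereMeasure n), T - ⟪x, w⟫ ∈ Icc (T - ‖x‖) (T + ‖x‖) :=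
  (ae_norm_eq_one_sphereMeasure hn).mono fun w hw => by
    have := abs_le.1 (abs_real_inner_le_norm x w)
    rw [hw, mul_one] at this
    exact ⟨by linarith, by linarith⟩

theorem ae_mem_closedBall_sphereMeasure (hn : n ≠ 0) :
    ∀ᵐ w ∂(sphereMeasure n), w ∈ closedBall (0 : Space n) 1 :=
  (ae_norm_eq_one_sphereMeasure hn).mono fun w hw => by simp [hw]

theorem integrable_planeWave (hn : n ≠ 0) {h : ℝ → ℝ} (hh : Continuous h) (T : ℝ) (x : Space n) :
    Integrable (fun w => h (T - ⟪x, w⟫)) (sphereMeasure n) :=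
  integrable_of_continuous_of_ball (ae_mem_closedBall_sphereMeasure hn) (hh.comp (by fun_prop))

theorem sphereMeasure_real_univ_pos : 0 < (sphereMeasure n).real univ :=
  ENNReal.toReal_pos sphereMeasure_univ_ne_zero (measure_ne_top _ _)

theorem le_waveAvg_profile (hn : n ≠ 0) {β T : ℝ} (hβ : 0 ≤ β) {x : Space n} (hx : ‖x‖ < T) :
    (sphereMeasure n).real univ * (1 + (2 * T) ^ 2) ^ (-β / 2)
      ≤ waveAvg (sphereMeasure n) (profile β) T x := by
  rw [← smul_eq_mul, ← integral_const]
  refine integral_mono_ae (integrable_const _)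
    (integrable_planeWave hn (contDiff_profile β).continuous T x) ?_
  filter_upwards [ae_sub_inner_mem hn T x] with w hw
  refine Real.rpow_le_rpow_of_nonpos (by positivity) ?_ (by linarith)
  have h1 : 0 ≤ T - ⟪x, w⟫ := (sub_nonneg.2 hx.le).trans hw.1
  have h2 : T - ⟪x, w⟫ ≤ 2 * T := hw.2.trans (by linarith)
  gcongr

theorem waveAvg_profile_pos (hn : n ≠ 0) {β T : ℝ} (hβ : 0 ≤ β) {x : Space n} (hx : ‖x‖ < T) :
    0 < waveAvg (sphereMeasure n) (profile β) T x :=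
  (mul_pos sphereMeasure_real_univ_pos (by positivity)).trans_le (le_waveAvg_profile hn hβ hx)

theorem waveAvg_deriv_profile_neg (hn : n ≠ 0) {β T : ℝ} (hβ : 0 < β) {x : Space n}
    (hx : ‖x‖ < T) : waveAvg (sphereMeasure n) (deriv (profile β)) T x < 0 := by
  have hae : ∀ᵐ w ∂(sphereMeasure n), 0 < -deriv (profile β) (T - ⟪x, w⟫) :=
    (ae_sub_inner_mem hn T x).mono fun w hw =>
      neg_pos.2 (deriv_profile_neg hβ ((sub_pos.2 hx).trans_le hw.1))
  have hi := (integrable_planeWave hn (contDiff_deriv (contDiff_profile β)).continuous T x).neg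
  have : 0 < ∫ w, -deriv (profile β) (T - ⟪x, w⟫) ∂(sphereMeasure n) := by
    refine (integral_pos_iff_support_of_nonneg_ae (hae.mono fun w hw => hw.le) hi).2 ?_
    refine (pos_iff_ne_zero.2 sphereMeasure_univ_ne_zero).trans_le (measure_mono_ae ?_)
    filter_upwards [hae] with w hw _
    exact hw.ne'
  rw [integral_neg] at this
  exact neg_pos.1 this

theorem exists_waveAvg_profile_le (hn : n ≠ 0) {β : ℝ} (hβ : 0 < β)
    (hγ : ((n : ℝ) - 1) / 2 < β + 1) :
    ∃ C : ℝ, 0 < C ∧ ∀ (T : ℝ) (x : Space n), ‖x‖ < T →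
      |waveAvg (sphereMeasure n) (profile β) T x|
        ≤ T * (C * T ^ (-(((n : ℝ) - 1) / 2)) * (T - ‖x‖) ^ (((n : ℝ) - 1) / 2 - (β + 1))) ∧
      |waveAvg (sphereMeasure n) (deriv (profile β)) T x|
        ≤ C * T ^ (-(((n : ℝ) - 1) / 2)) * (T - ‖x‖) ^ (((n : ℝ) - 1) / 2 - (β + 1)) := by
  obtain ⟨C, hC, h⟩ := exists_waveAvg_rpow_le hn hγ (by linarith)
  -- The 2 comes from the phase being at most 2T, the β from differentiating the profile; the sum
  -- serves both bounds.
  refine ⟨(2 + β) * C, by positivity, fun T x hx => ?_⟩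
  have hT : 0 < T := (norm_nonneg x).trans_lt hx
  have hD : 0 < T - ‖x‖ := sub_pos.2 hx
  set P := T ^ (-(((n : ℝ) - 1) / 2)) * (T - ‖x‖) ^ (((n : ℝ) - 1) / 2 - (β + 1)) with hP
  have hP0 : 0 ≤ P := by positivity
  have hae := ae_sub_inner_mem hn T x
  have hi : Integrable (fun w => (T - ⟪x, w⟫) ^ (-(β + 1))) (sphereMeasure n) := by
    refine Integrable.of_bound (Measurable.aestronglyMeasurable (by fun_prop))
      ((T - ‖x‖) ^ (-(β + 1))) (hae.mono fun w hw => ?_)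
    rw [Real.norm_of_nonneg (Real.rpow_nonneg (hD.le.trans hw.1) _)]
    exact Real.rpow_le_rpow_of_nonpos hD hw.1 (by linarith)
  have hle := h T x hx
  rw [← hP] at hle
  constructor
  · calc |waveAvg (sphereMeasure n) (profile β) T x|
        ≤ ∫ w, 2 * T * (T - ⟪x, w⟫) ^ (-(β + 1)) ∂(sphereMeasure n) := by
          rw [← Real.norm_eq_abs, waveAvg]
          refine norm_integral_le_of_norm_le (hi.const_mul _) (hae.mono fun w hw => ?_)
          have hs := hD.trans_le hw.1
          rw [Real.norm_of_nonneg (profile_pos _ _).le]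
          refine (profile_le hβ.le hs).trans
            (mul_le_mul_of_nonneg_right ?_ (Real.rpow_nonneg hs.le _))
          linarith [hw.2]
      _ = 2 * T * waveAvg (sphereMeasure n) (fun s => s ^ (-(β + 1))) T x := by
          rw [integral_const_mul]; rfl
      _ ≤ 2 * T * (C * P) := by gcongr
      _ ≤ T * ((2 + β) * (C * P)) := by
          have : 0 ≤ T * (β * (C * P)) := by positivity
          linarith
      _ = _ := by rw [hP]; ring
  · calc |waveAvg (sphereMeasure n) (deriv (profile β)) T x|
        ≤ ∫ w, β * (T - ⟪x, w⟫) ^ (-(β + 1)) ∂(sphereMeasure n) := by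
          rw [← Real.norm_eq_abs, waveAvg]
          refine norm_integral_le_of_norm_le (hi.const_mul _) (hae.mono fun w hw => ?_)
          rw [Real.norm_eq_abs]
          exact abs_deriv_profile_le hβ.le (hD.trans_le hw.1)
      _ = β * waveAvg (sphereMeasure n) (fun s => s ^ (-(β + 1))) T x := by
          rw [integral_const_mul]; rfl
      _ ≤ β * (C * P) := by gcongr
      _ ≤ (2 + β) * (C * P) := by gcongr; linarith
      _ = _ := by rw [hP]; ring

/-! ### Hölder's inequality inside the light cone -/

/-- Integration in polar coordinates of a power of the distance to the light cone. -/
theorem setIntegral_cone_le (hn : n ≠ 0) {T a : ℝ} (hT : 1 ≤ T) :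
    ∫ x in closedBall (0 : Space n) (T - 1), (T - ‖x‖) ^ (-a)
      ≤ n * volume.real (ball (0 : Space n) 1) * T ^ ((n : ℝ) - 1) * ∫ s in 1..T, s ^ (-a) := by
  have : NeZero n := ⟨hn⟩
  set f : ℝ → ℝ := (Iic (T - 1)).indicator fun r => (T - r) ^ (-a) with hf
  have h1 : ∫ x in closedBall (0 : Space n) (T - 1), (T - ‖x‖) ^ (-a) = ∫ x : Space n, f ‖x‖ := by
    rw [← integral_indicator measurableSet_closedBall]
    refine integral_congr_ae (Eventually.of_forall fun x => ?_)
    simp [hf, indicator]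
  have hcont : ContinuousOn (fun s : ℝ => s ^ (-a)) (uIcc 1 T) := by
    intro s hs
    rw [uIcc_of_le hT] at hs
    exact (Real.continuousAt_rpow_const _ _ (Or.inl (by linarith [hs.1]))).continuousWithinAt
  have hii : IntervalIntegrable (fun r : ℝ => (T - r) ^ (-a)) volume 0 (T - 1) := by
    have := (hcont.intervalIntegrable).comp_sub_left T
    simpa using this.symm
  have h2 : ∫ r in Ioi (0 : ℝ), r ^ (n - 1) • f r
      ≤ T ^ ((n : ℝ) - 1) * ∫ s in 1..T, s ^ (-a) := by
    have e1 : ∫ r in Ioi (0 : ℝ), r ^ (n - 1) • f r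
        = ∫ r in (0 : ℝ)..(T - 1), r ^ (n - 1) * (T - r) ^ (-a) := by
      rw [intervalIntegral.integral_of_le (by linarith), ← Ioi_inter_Iic,
        ← setIntegral_indicator measurableSet_Iic]
      refine integral_congr_ae (Eventually.of_forall fun r => ?_)
      simp only [hf, indicator]
      split_ifs <;> simp
    have e2 : ∫ s in 1..T, s ^ (-a) = ∫ r in (0 : ℝ)..(T - 1), (T - r) ^ (-a) := by
      rw [intervalIntegral.integral_comp_sub_left (fun s => s ^ (-a)) T]
      simp
    rw [e1, e2, ← intervalIntegral.integral_const_mul]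
    refine intervalIntegral.integral_mono_on (by linarith)
      (hii.continuousOn_mul (by fun_prop)) (hii.const_mul _) fun r hr => ?_
    refine mul_le_mul_of_nonneg_right ?_ (Real.rpow_nonneg (by linarith [hr.2]) _)
    rw [show (n : ℝ) - 1 = (n - 1 : ℕ) by
      rw [Nat.cast_sub (Nat.one_le_iff_ne_zero.2 hn), Nat.cast_one], Real.rpow_natCast]
    exact pow_le_pow_left₀ hr.1 (by linarith [hr.2]) _
  rw [h1, integral_fun_norm_addHaar, finrank_euclideanSpace_fin, nsmul_eq_mul, smul_eq_mul,
    mul_assoc, mul_assoc]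
  gcongr

/-- The exponent -a/q is chosen so that the q-th power of the weight is (T-‖x‖)^(-a), whose integral
is bounded by polar coordinates. On the support T - ‖x‖ ≥ 1, so the singularity on the cone is never
met. -/
theorem abs_integral_mul_le_of_cone {p q : ℝ} (hpq : p.HolderConjugate q) (hn : n ≠ 0)
    {T a K : ℝ} (hT : 1 ≤ T) (hK : 0 ≤ K) {f φ : Space n → ℝ} (hfm : AEStronglyMeasurable f)
    (hf : Integrable fun x => |f x| ^ p) (hf0 : ∀ᵐ x, T - 1 < ‖x‖ → f x = 0)
    (hφ : ∀ x, ‖x‖ ≤ T - 1 → |φ x| ≤ K * (T - ‖x‖) ^ (-a / q)) :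
    |∫ x, f x * φ x| ≤ K * ((∫ x, |f x| ^ p) ^ (1 / p) *
      (n * volume.real (ball (0 : Space n) 1) * T ^ ((n : ℝ) - 1) *
        ∫ s in 1..T, s ^ (-a)) ^ (1 / q)) := by
  have hp := hpq.pos
  have hq := hpq.symm.pos
  set B : Set (Space n) := closedBall 0 (T - 1)
  have hpos : ∀ x ∈ B, 0 < T - ‖x‖ := fun x hx => by
    have := mem_closedBall_zero_iff.1 hx; linarith
  have hcont : ∀ b : ℝ, ContinuousOn (fun x : Space n => (T - ‖x‖) ^ b) B := fun b x hx =>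
    ((by fun_prop : ContinuousAt (fun x : Space n => T - ‖x‖) x).rpow_const
      (Or.inl (hpos x hx).ne')).continuousWithinAt
  have hp0 : ENNReal.ofReal p ≠ 0 := by simpa using hp
  have hmf : MemLp (fun x => |f x|) (ENNReal.ofReal p) (volume.restrict B) := by
    refine (integrable_norm_rpow_iff hfm.norm hp0 ENNReal.ofReal_ne_top).1 ?_ |>.restrict B
    simpa [ENNReal.toReal_ofReal hp.le] using hf
  have hmg : MemLp (fun x : Space n => (T - ‖x‖) ^ (-a / q)) (ENNReal.ofReal q)
      (volume.restrict B) := by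
    obtain ⟨C, hC⟩ := (isCompact_closedBall (0 : Space n) (T - 1)).exists_bound_of_continuousOn
      (hcont (-a / q))
    have : IsFiniteMeasure ((volume : Measure (Space n)).restrict B) :=
      ⟨by rw [Measure.restrict_apply_univ]; exact measure_closedBall_lt_top⟩
    exact MemLp.of_bound ((hcont _).aestronglyMeasurable measurableSet_closedBall) C
      ((ae_restrict_mem measurableSet_closedBall).mono hC)
  have hg0 : ∀ᵐ x ∂volume.restrict B, (0 : ℝ) ≤ (T - ‖x‖) ^ (-a / q) :=
    (ae_restrict_mem measurableSet_closedBall).mono fun x hx => Real.rpow_nonneg (hpos x hx).le _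
  have hint : IntegrableOn (fun x => |f x| * (T - ‖x‖) ^ (-a / q)) B := by
    have := hpq.ennrealOfReal
    exact hmf.integrable_mul hmg
  have h0 : ∫ x, f x * φ x = ∫ x in B, f x * φ x := by
    refine (setIntegral_eq_integral_of_ae_compl_eq_zero ?_).symm
    filter_upwards [hf0] with x hx hxB
    rw [hx (not_le.1 fun h => hxB (mem_closedBall_zero_iff.2 h)), zero_mul]
  have h1 : |∫ x, f x * φ x| ≤ ∫ x in B, K * (|f x| * (T - ‖x‖) ^ (-a / q)) := by
    rw [h0, ← Real.norm_eq_abs]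
    refine norm_integral_le_of_norm_le (hint.const_mul K)
      ((ae_restrict_mem measurableSet_closedBall).mono fun x hx => ?_)
    rw [norm_mul, Real.norm_eq_abs, Real.norm_eq_abs]
    have := mul_le_mul_of_nonneg_left (hφ x (mem_closedBall_zero_iff.1 hx)) (abs_nonneg (f x))
    linarith
  refine h1.trans ?_
  rw [integral_const_mul]
  refine mul_le_mul_of_nonneg_left ?_ hK
  refine (integral_mul_le_Lp_mul_Lq_of_nonneg hpq
    (Eventually.of_forall fun x => abs_nonneg _) hg0 hmf hmg).trans ?_
  refine mul_le_mul ?_ ?_ ?_ ?_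
  · refine Real.rpow_le_rpow (integral_nonneg fun x => Real.rpow_nonneg (abs_nonneg _) _) ?_
      (by positivity)
    exact setIntegral_le_integral hf
      (Eventually.of_forall fun x => Real.rpow_nonneg (abs_nonneg _) _)
  · refine Real.rpow_le_rpow (integral_nonneg_of_ae (hg0.mono fun x hx => Real.rpow_nonneg hx _)) ?_
      (by positivity)
    refine le_trans (le_of_eq ?_) (setIntegral_cone_le hn hT)
    refine setIntegral_congr_fun measurableSet_closedBall fun x hx => ?_
    rw [← Real.rpow_mul (hpos x hx).le, div_mul_cancel₀ _ hq.ne']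
  · exact Real.rpow_nonneg (integral_nonneg_of_ae (hg0.mono fun x hx => Real.rpow_nonneg hx _)) _
  · exact Real.rpow_nonneg (integral_nonneg fun x => Real.rpow_nonneg (abs_nonneg _) _) _

/-! ### Pairing curves in `L²` with time dependent test functions -/

/-- `f` vanishes almost everywhere outside `K`. -/
def VanishesOff (K : Set (Space n)) (f : L2 n) : Prop := ∀ᵐ x, x ∉ K → f x = 0

theorem VanishesOff.sub {K : Set (Space n)} {f g : L2 n} (hf : VanishesOff K f)
    (hg : VanishesOff K g) : VanishesOff K (f - g) := by
  filter_upwards [hf, hg, Lp.coeFn_sub f g] with x h1 h2 h3 hx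
  rw [h3, Pi.sub_apply, h1 hx, h2 hx, sub_zero]

theorem VanishesOff.smul {K : Set (Space n)} {f : L2 n} (hf : VanishesOff K f) (c : ℝ) :
    VanishesOff K (c • f) := by
  filter_upwards [hf, Lp.coeFn_smul c f] with x h1 h3 hx
  rw [h3, Pi.smul_apply, h1 hx, smul_zero]

theorem VanishesOff.mono {K K' : Set (Space n)} {f : L2 n} (hf : VanishesOff K f) (h : K ⊆ K') :
    VanishesOff K' f := by
  filter_upwards [hf] with x hx hx'
  exact hx fun hk => hx' (h hk)

theorem VanishesOff.integrable_mul {K : Set (Space n)} (hK : IsCompact K) {f : L2 n}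
    (hf : VanishesOff K f) {φ : Space n → ℝ} (hφ : Continuous φ) :
    Integrable fun x => f x * φ x := by
  have h1 : IntegrableOn (f : Space n → ℝ) K := by
    have : IsFiniteMeasure ((volume : Measure (Space n)).restrict K) :=
      ⟨by rw [Measure.restrict_apply_univ]; exact hK.measure_lt_top⟩
    exact ((Lp.memLp f).restrict K).integrable (by norm_num)
  refine (h1.mul_continuousOn hφ.continuousOn hK).integrable_of_ae_notMem_eq_zero ?_
  filter_upwards [hf] with x hx hxK
  rw [hx hxK, zero_mul]

/-- Cauchy–Schwarz for |f| against the indicator of K; c is the norm of that indicator. -/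
theorem exists_abs_integral_mul_le {K : Set (Space n)} (hK : IsCompact K) :
    ∃ c : ℝ, 0 ≤ c ∧ ∀ f : L2 n, VanishesOff K f → ∀ (φ : Space n → ℝ) (δ : ℝ), 0 ≤ δ →
      (∀ x ∈ K, |φ x| ≤ δ) → |∫ x, f x * φ x| ≤ δ * (c * ‖f‖) := by
  have hKm := hK.measurableSet
  have hKf : volume K ≠ ⊤ := hK.measure_lt_top.ne
  refine ⟨‖indicatorConstLp 2 hKm hKf (1 : ℝ)‖, norm_nonneg _, fun f hf φ δ hδ hφ => ?_⟩
  have hint : IntegrableOn (fun x => ‖f x‖) K := by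
    have : IsFiniteMeasure ((volume : Measure (Space n)).restrict K) :=
      ⟨by rw [Measure.restrict_apply_univ]; exact hK.measure_lt_top⟩
    exact (((Lp.memLp f).restrict K).integrable (by norm_num)).norm
  have h0 : ∫ x, f x * φ x = ∫ x in K, f x * φ x := by
    refine (setIntegral_eq_integral_of_ae_compl_eq_zero ?_).symm
    filter_upwards [hf] with x hx hxK
    rw [hx hxK, zero_mul]
  have h1 : ∫ x in K, ‖f x‖ = ∫ x in K, (|f| : L2 n) x := by
    refine integral_congr_ae (ae_restrict_of_ae ?_)
    filter_upwards [Lp.coeFn_abs f] with x hx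
    rw [hx, Real.norm_eq_abs]
  calc |∫ x, f x * φ x| ≤ ∫ x in K, δ * ‖f x‖ := by
        rw [h0, ← Real.norm_eq_abs]
        refine norm_integral_le_of_norm_le (hint.const_mul δ)
          ((ae_restrict_mem hKm).mono fun x hx => ?_)
        rw [norm_mul, mul_comm, Real.norm_eq_abs (φ x)]
        exact mul_le_mul_of_nonneg_right (hφ x hx) (norm_nonneg _)
    _ = δ * ⟪indicatorConstLp 2 hKm hKf (1 : ℝ), (|f| : L2 n)⟫ := by
        rw [integral_const_mul, h1, L2.inner_indicatorConstLp_one]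
    _ ≤ _ := by
        refine mul_le_mul_of_nonneg_left ((real_inner_le_norm _ _).trans ?_) hδ
        rw [norm_abs_eq_norm]

theorem tendsto_integral_mul {K : Set (Space n)} (hK : IsCompact K) {l : Filter ℝ}
    {f : ℝ → L2 n} {f₀ : L2 n} (hf : Tendsto f l (𝓝 f₀)) (hfK : ∀ᶠ s in l, VanishesOff K (f s))
    (hf₀ : VanishesOff K f₀) {Φ : ℝ → Space n → ℝ} {φ : Space n → ℝ} (hΦ : ∀ s, Continuous (Φ s))
    (hφ : Continuous φ) (hu : TendstoUniformlyOn Φ φ l K) :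
    Tendsto (fun s => ∫ x, f s x * Φ s x) l (𝓝 (∫ x, f₀ x * φ x)) := by
  obtain ⟨c, hc, hb⟩ := exists_abs_integral_mul_le hK
  obtain ⟨C, hC⟩ := hK.exists_bound_of_continuousOn hφ.continuousOn
  have hlim : Tendsto (fun s => ‖f s - f₀‖) l (𝓝 0) := by
    simpa using (hf.sub_const f₀).norm
  have hfn : Tendsto (fun s => ‖f s‖) l (𝓝 ‖f₀‖) := hf.norm
  rw [Metric.tendsto_nhds]
  intro ε hε
  set δ := ε / (2 * (c * (‖f₀‖ + 1)) + 1) with hδ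
  have hδ0 : 0 < δ := by positivity
  set η := ε / (2 * ((|C| + 1) * (c + 1))) with hη
  have hη0 : 0 < η := by positivity
  filter_upwards [hfK, Metric.tendstoUniformlyOn_iff.1 hu δ hδ0, hlim.eventually_lt_const hη0,
    hfn.eventually_lt_const (lt_add_one ‖f₀‖)] with s h1 h2 h3 h4
  have e1 : ∫ x, f s x * Φ s x = (∫ x, f s x * (Φ s x - φ x)) + ∫ x, f s x * φ x := by
    rw [← integral_add (h1.integrable_mul hK (φ := fun x => Φ s x - φ x) ((hΦ s).sub hφ)) (h1.integrable_mul hK hφ)]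
    exact integral_congr_ae (Eventually.of_forall fun x => by ring)
  have e2 : ∫ x, f s x * φ x = (∫ x, (f s - f₀ : L2 n) x * φ x) + ∫ x, f₀ x * φ x := by
    rw [← integral_add ((h1.sub hf₀).integrable_mul hK hφ) (hf₀.integrable_mul hK hφ)]
    refine integral_congr_ae ?_
    filter_upwards [Lp.coeFn_sub (f s) f₀] with x hx
    rw [hx, Pi.sub_apply]
    ring
  have b1 := hb (f s) h1 (fun x => Φ s x - φ x) δ hδ0.le fun x hx => by
    have := h2 x hx
    rw [dist_comm, Real.dist_eq] at this
    exact this.le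
  have b2 := hb (f s - f₀) (h1.sub hf₀) φ (|C| + 1) (by positivity) fun x hx =>
    ((hC x hx).trans (le_abs_self C)).trans (by linarith)
  have b1' : δ * (c * ‖f s‖) < ε / 2 := by
    have : δ * (c * ‖f s‖) ≤ δ * (c * (‖f₀‖ + 1)) := by gcongr
    refine this.trans_lt ?_
    rw [hδ, div_mul_eq_mul_div, div_lt_div_iff₀ (by positivity) two_pos]
    nlinarith [mul_nonneg hc (add_nonneg (norm_nonneg f₀) zero_le_one)]
  have b2' : (|C| + 1) * (c * ‖f s - f₀‖) ≤ ε / 2 := by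
    calc (|C| + 1) * (c * ‖f s - f₀‖) ≤ (|C| + 1) * ((c + 1) * η) := by
          gcongr
          linarith
      _ = ε / 2 := by rw [hη]; field_simp
  rw [Real.dist_eq, e1, e2, ← add_assoc, add_sub_cancel_right]
  exact (abs_add_le _ _).trans_lt (by linarith)

theorem tendstoUniformlyOn_of_continuous {K : Set (Space n)} (hK : IsCompact K)
    {Φ : ℝ → Space n → ℝ} (hΦ : Continuous (Function.uncurry Φ)) (t : ℝ) :
    TendstoUniformlyOn Φ (Φ t) (𝓝 t) K := by
  rw [Metric.tendstoUniformlyOn_iff]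
  intro ε hε
  obtain ⟨V, hV, h⟩ := hK.mem_uniformity_of_prod (f := Φ) (s := univ) hΦ.continuousOn (mem_univ t)
    (Metric.dist_mem_uniformity hε)
  rw [nhdsWithin_univ] at hV
  filter_upwards [hV] with s hs x hx
  rw [dist_comm]
  exact h s hs x hx

/-- The mean value inequality is applied to Φ s x - s Φ' t x, whose time derivative Φ' s x - Φ' t x
is small uniformly in x ∈ K. -/
theorem tendstoUniformlyOn_slope {K : Set (Space n)} (hK : IsCompact K)
    {Φ Φ' : ℝ → Space n → ℝ} (hΦ' : Continuous (Function.uncurry Φ'))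
    (hd : ∀ s x, HasDerivAt (fun s => Φ s x) (Φ' s x) s) (t : ℝ) :
    TendstoUniformlyOn (fun s x => (s - t)⁻¹ * (Φ s x - Φ t x)) (Φ' t) (𝓝[≠] t) K := by
  rw [Metric.tendstoUniformlyOn_iff]
  intro ε hε
  have hu := Metric.tendstoUniformlyOn_iff.1 (tendstoUniformlyOn_of_continuous hK hΦ' t)
    (ε / 2) (half_pos hε)
  obtain ⟨r, hr, hball⟩ := Metric.eventually_nhds_iff_ball.1 hu
  filter_upwards [nhdsWithin_le_nhds (ball_mem_nhds t hr), self_mem_nhdsWithin] with s hs hst x hx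
  have hst' : s - t ≠ 0 := sub_ne_zero.2 hst
  have hmv := (convex_ball t r).norm_image_sub_le_of_norm_hasDerivWithin_le
    (f := fun s => Φ s x - s * Φ' t x) (f' := fun s => Φ' s x - Φ' t x) (C := ε / 2)
    (fun σ _ => ((hd σ x).sub (by simpa using (hasDerivAt_id σ).mul_const (Φ' t x))).hasDerivWithinAt)
    (fun σ hσ => by
      have := hball σ hσ x hx
      rw [dist_comm, Real.dist_eq] at this
      exact this.le) (mem_ball_self hr) hs
  rw [dist_comm, Real.dist_eq]
  have e : (s - t)⁻¹ * (Φ s x - Φ t x) - Φ' t x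
      = (s - t)⁻¹ * (Φ s x - s * Φ' t x - (Φ t x - t * Φ' t x)) := by
    field_simp
    ring
  rw [e, abs_mul, abs_inv]
  calc |s - t|⁻¹ * |Φ s x - s * Φ' t x - (Φ t x - t * Φ' t x)|
      ≤ |s - t|⁻¹ * (ε / 2 * |s - t|) := by
        gcongr
        exact hmv
    _ = ε / 2 := by
        have := abs_pos.2 hst'
        field_simp
    _ < ε := half_lt_self hε

section Pairing

variable {R : ℝ} {f : ℝ → L2 n}

/-- The values of `f` at nonnegative times are supported in the balls `‖x‖ ≤ t + R`. -/
def ConeSupport (R : ℝ) (f : ℝ → L2 n) : Prop :=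
  ∀ t, 0 ≤ t → VanishesOff (closedBall 0 (t + R)) (f t)

theorem ConeSupport.eventually (hf : ConeSupport R f) {t : ℝ} (ht : 0 < t) :
    ∀ᶠ s in 𝓝 t, VanishesOff (closedBall 0 (t + 1 + R)) (f s) := by
  filter_upwards [eventually_gt_nhds ht, eventually_lt_nhds (lt_add_one t)] with s hs hs'
  exact (hf s hs.le).mono (closedBall_subset_closedBall (by linarith))

theorem ConeSupport.self (hf : ConeSupport R f) {t : ℝ} (ht : 0 ≤ t) :
    VanishesOff (closedBall 0 (t + 1 + R)) (f t) :=
  (hf t ht).mono (closedBall_subset_closedBall (by linarith))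

theorem ConeSupport.integrable (hf : ConeSupport R f) {t : ℝ} (ht : 0 ≤ t) {φ : Space n → ℝ}
    (hφ : Continuous φ) : Integrable fun x => f t x * φ x :=
  (hf t ht).integrable_mul (isCompact_closedBall _ _) hφ

theorem ConeSupport.continuousOn_integral_mul (hf : ConeSupport R f)
    (hc : ContinuousOn f (Ici 0)) {Φ : ℝ → Space n → ℝ} (hΦ : Continuous (Function.uncurry Φ)) :
    ContinuousOn (fun s => ∫ x, f s x * Φ s x) (Ici 0) := by
  intro t ht
  have hΦs : ∀ s, Continuous (Φ s) := fun s => hΦ.comp (by fun_prop : Continuous fun x => (s, x))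
  refine tendsto_integral_mul (isCompact_closedBall (0 : Space n) (t + 1 + R)) (hc t ht) ?_
    (hf.self ht) hΦs (hΦs t) ?_
  · filter_upwards [self_mem_nhdsWithin, nhdsWithin_le_nhds (eventually_lt_nhds (lt_add_one t))]
      with s hs hs'
    exact (hf s hs).mono (closedBall_subset_closedBall (by linarith))
  · exact fun w hw => nhdsWithin_le_nhds
      (tendstoUniformlyOn_of_continuous (isCompact_closedBall _ _) hΦ t w hw)

/-- Product rule for the pairing of a curve in `L²` with a time dependent test function. -/
theorem ConeSupport.hasDerivAt_integral_mul (hf : ConeSupport R f)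
    (hc : ContinuousOn f (Ici 0)) {Φ Φ' : ℝ → Space n → ℝ} (hΦ : Continuous (Function.uncurry Φ))
    (hΦ' : Continuous (Function.uncurry Φ'))
    (hd : ∀ s x, HasDerivAt (fun s => Φ s x) (Φ' s x) s) {t D : ℝ} (ht : 0 < t)
    (hw : HasDerivAt (fun s => ∫ x, f s x * Φ t x) D t) :
    HasDerivAt (fun s => ∫ x, f s x * Φ s x) (D + ∫ x, f t x * Φ' t x) t := by
  have hK := isCompact_closedBall (0 : Space n) (t + 1 + R)
  have hΦs : ∀ s, Continuous (Φ s) := fun s => hΦ.comp (by fun_prop : Continuous fun x => (s, x))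
  have hΦs' : ∀ s, Continuous (Φ' s) :=
    fun s => hΦ'.comp (by fun_prop : Continuous fun x => (s, x))
  -- The factor Φ s - Φ t vanishes at s = t, so continuity of f is enough here. This matters for f =
  -- u_t, which is differentiable only when tested against a fixed function.
  have h1 : HasDerivAt (fun s => ∫ x, f s x * (Φ s x - Φ t x)) (∫ x, f t x * Φ' t x) t := by
    rw [hasDerivAt_iff_tendsto_slope]
    have hct : ContinuousAt f t := (hc t ht.le).continuousAt (Ici_mem_nhds ht)
    have := tendsto_integral_mul hK (hct.tendsto.mono_left nhdsWithin_le_nhds)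
      (nhdsWithin_le_nhds (hf.eventually ht)) (hf.self ht.le)
      (fun s => by have := hΦs s; have := hΦs t; fun_prop) (hΦs' t)
      (tendstoUniformlyOn_slope hK hΦ' hd t)
    refine this.congr fun s => ?_
    rw [slope_def_field]
    simp only [sub_self, mul_zero, integral_zero, sub_zero]
    rw [div_eq_inv_mul, ← integral_const_mul]
    exact integral_congr_ae (Eventually.of_forall fun x => by ring)
  refine (hw.add h1).congr_of_eventuallyEq ?_
  filter_upwards [hf.eventually ht] with s hs
  simp only [Pi.add_apply]
  rw [← integral_add (hs.integrable_mul hK (hΦs t))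
    (hs.integrable_mul hK (φ := fun x => Φ s x - Φ t x) ((hΦs s).sub (hΦs t)))]
  exact integral_congr_ae (Eventually.of_forall fun x => by ring)

theorem ConeSupport.hasDerivAt_integral_mul_const (hf : ConeSupport R f) {g : ℝ → L2 n}
    (hg : ConeSupport R g) {t : ℝ} (ht : 0 < t) (hfg : HasDerivAt f (g t) t) {φ : Space n → ℝ}
    (hφ : Continuous φ) : HasDerivAt (fun s => ∫ x, f s x * φ x) (∫ x, g t x * φ x) t := by
  have hK := isCompact_closedBall (0 : Space n) (t + 1 + R)
  rw [hasDerivAt_iff_tendsto_slope] at hfg ⊢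
  have hft := hf.self ht.le
  have hev : ∀ᶠ s in 𝓝[≠] t, VanishesOff (closedBall 0 (t + 1 + R)) (f s) :=
    nhdsWithin_le_nhds (hf.eventually ht)
  have := tendsto_integral_mul hK hfg
    (hev.mono fun s hs => (hs.sub hft).smul (s - t)⁻¹)
    (hg.self ht.le) (fun _ => hφ) hφ
    (Metric.tendstoUniformlyOn_iff.2 fun ε hε => Eventually.of_forall fun s x _ => by simpa)
  refine this.congr' ?_
  filter_upwards [hev] with s hs
  rw [slope_def_field, div_eq_inv_mul, ← integral_sub (hs.integrable_mul hK hφ)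
    (hft.integrable_mul hK hφ), ← integral_const_mul]
  refine integral_congr_ae ?_
  filter_upwards [Lp.coeFn_sub (f s) (f t), Lp.coeFn_smul (s - t)⁻¹ (f s - f t)] with x h1 h2
  rw [slope_def_module, h2, Pi.smul_apply, h1, Pi.sub_apply, smul_eq_mul]
  ring

end Pairing

/-! ### Moments and Wronskians of a global solution -/

/-- The content of the wave equation that the blow-up argument uses, for a global solution. -/
structure GlobalSolution (p R : ℝ) (U v : ℝ → L2 n) : Prop where
  position_support : ConeSupport R U
  velocity_support : ConeSupport R v
  position_continuous : ContinuousOn U (Ici 0)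
  velocity_continuous : ContinuousOn v (Ici 0)
  hasDerivAt : ∀ t, 0 < t → HasDerivAt U (v t) t
  locallyIntegrable : ∀ t, 0 ≤ t → LocallyIntegrable fun x => |U t x| ^ p
  equation : ∀ φ : Space n → ℝ, IsTestFunction φ → ∀ t, 0 < t →
    HasDerivAt (fun s => ∫ x, v s x * φ x)
      ((∫ x, U t x * Δ φ x) + ∫ x, |U t x| ^ p * φ x) t

namespace GlobalSolution

variable {p R : ℝ} {U v : ℝ → L2 n}

theorem integrable_rpow_mul (h : GlobalSolution p R U v) (hp : 0 < p) {t : ℝ} (ht : 0 ≤ t)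
    {φ : Space n → ℝ} (hφ : Continuous φ) : Integrable fun x => |U t x| ^ p * φ x := by
  have hK := isCompact_closedBall (0 : Space n) (t + R)
  refine (((h.locallyIntegrable t ht).integrableOn_isCompact hK).mul_continuousOn
    hφ.continuousOn hK).integrable_of_ae_notMem_eq_zero ?_
  filter_upwards [h.position_support t ht] with x hx hxK
  rw [hx hxK, abs_zero, Real.zero_rpow hp.ne', zero_mul]

theorem integrable_rpow (h : GlobalSolution p R U v) (hp : 0 < p) {t : ℝ} (ht : 0 ≤ t) :
    Integrable fun x => |U t x| ^ p := by
  simpa using h.integrable_rpow_mul hp ht (φ := fun _ => 1) continuous_const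

/-- Finite propagation speed removes the compact support of the test function: for times near t a
spatial cutoff is invisible to the solution. -/
theorem equation_of_contDiff (h : GlobalSolution p R U v) (hR : 0 < R) (hp : 0 < p)
    {φ : Space n → ℝ} (hφ : ContDiff ℝ ∞ φ) {t : ℝ} (ht : 0 < t) :
    HasDerivAt (fun s => ∫ x, v s x * φ x)
      ((∫ x, U t x * Δ φ x) + ∫ x, |U t x| ^ p * φ x) t := by
  -- The supports up to time t + 1 lie in the ball of radius t + 1 + R. The extra unit makes χ = 1
  -- near each of its points, so that Laplacians agree there too.
  let χ : ContDiffBump (0 : Space n) := ⟨t + 2 + R, t + 3 + R, by linarith, by linarith⟩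
  have hχ1 : ∀ x ∈ closedBall (0 : Space n) (t + 2 + R), χ x = 1 :=
    fun x hx => χ.one_of_mem_closedBall hx
  have htest : IsTestFunction fun x => χ x * φ x :=
    ⟨χ.contDiff.mul hφ, χ.hasCompactSupport.mul_right⟩
  have h1 := h.equation _ htest t ht
  have e1 : ∀ x ∈ closedBall (0 : Space n) (t + 1 + R), χ x * φ x = φ x := fun x hx => by
    rw [hχ1 x (closedBall_subset_closedBall (by linarith) hx), one_mul]
  have e2 : ∀ x ∈ closedBall (0 : Space n) (t + 1 + R), Δ (fun x => χ x * φ x) x = Δ φ x := by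
    intro x hx
    refine (InnerProductSpace.laplacian_congr_nhds ?_).eq_of_nhds
    filter_upwards [isOpen_ball.mem_nhds (mem_ball_zero_iff.2
      ((mem_closedBall_zero_iff.1 hx).trans_lt (by linarith : t + 1 + R < t + 2 + R)))] with y hy
    rw [hχ1 y (ball_subset_closedBall hy), one_mul]
  have e3 : ∫ x, U t x * Δ (fun x => χ x * φ x) x = ∫ x, U t x * Δ φ x := by
    refine integral_congr_ae ?_
    filter_upwards [h.position_support.self ht.le] with x hx
    by_cases hxK : x ∈ closedBall (0 : Space n) (t + 1 + R)
    · rw [e2 x hxK]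
    · rw [hx hxK, zero_mul, zero_mul]
  have e4 : ∫ x, |U t x| ^ p * (χ x * φ x) = ∫ x, |U t x| ^ p * φ x := by
    refine integral_congr_ae ?_
    filter_upwards [h.position_support.self ht.le] with x hx
    by_cases hxK : x ∈ closedBall (0 : Space n) (t + 1 + R)
    · rw [e1 x hxK]
    · rw [hx hxK, abs_zero, Real.zero_rpow hp.ne', zero_mul, zero_mul]
  rw [e3, e4] at h1
  refine h1.congr_of_eventuallyEq ?_
  filter_upwards [h.velocity_support.eventually ht] with s hs
  refine integral_congr_ae ?_
  filter_upwards [hs] with x hx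
  by_cases hxK : x ∈ closedBall (0 : Space n) (t + 1 + R)
  · rw [e1 x hxK]
  · rw [hx hxK, zero_mul, zero_mul]

/-- The test function attached to the exponent `β`. -/
noncomputable def weight (n : ℕ) (R β t : ℝ) (x : Space n) : ℝ :=
  waveAvg (sphereMeasure n) (profile β) (t + (R + 1)) x

/-- The time derivative of `weight`. -/
noncomputable def weightDeriv (n : ℕ) (R β t : ℝ) (x : Space n) : ℝ :=
  waveAvg (sphereMeasure n) (deriv (profile β)) (t + (R + 1)) x

theorem contDiff_shift_waveAvg (hn : n ≠ 0) {h : ℝ → ℝ} (hh : ContDiff ℝ ∞ h) (ρ : ℝ) :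
    ContDiff ℝ ∞ (Function.uncurry fun t x => waveAvg (sphereMeasure n) h (t + ρ) x) :=
  (contDiff_waveAvg (ae_mem_closedBall_sphereMeasure hn) hh).comp
    ((contDiff_fst.add contDiff_const).prodMk contDiff_snd)

theorem hasDerivAt_shift_waveAvg (hn : n ≠ 0) {h : ℝ → ℝ} (hh : ContDiff ℝ ∞ h) (ρ t : ℝ)
    (x : Space n) : HasDerivAt (fun s => waveAvg (sphereMeasure n) h (s + ρ) x)
      (waveAvg (sphereMeasure n) (deriv h) (t + ρ) x) t :=
  (hasDerivAt_waveAvg (ae_mem_closedBall_sphereMeasure hn) hh (t + ρ) x).comp_add_const t ρ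

theorem continuous_weight (hn : n ≠ 0) (R β : ℝ) :
    Continuous (Function.uncurry (weight n R β)) :=
  (contDiff_shift_waveAvg hn (contDiff_profile β) (R + 1)).continuous

theorem continuous_weightDeriv (hn : n ≠ 0) (R β : ℝ) :
    Continuous (Function.uncurry (weightDeriv n R β)) :=
  (contDiff_shift_waveAvg hn (contDiff_deriv (contDiff_profile β)) (R + 1)).continuous

theorem continuous_weight_apply (hn : n ≠ 0) (R β t : ℝ) : Continuous (weight n R β t) :=
  (continuous_weight hn R β).comp (by fun_prop : Continuous fun x => (t, x))

theorem continuous_weightDeriv_apply (hn : n ≠ 0) (R β t : ℝ) :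
    Continuous (weightDeriv n R β t) :=
  (continuous_weightDeriv hn R β).comp (by fun_prop : Continuous fun x => (t, x))

/-- `∫ u G`. -/
noncomputable def moment (R β : ℝ) (U : ℝ → L2 n) (t : ℝ) : ℝ := ∫ x, U t x * weight n R β t x

/-- `∫ u ∂ₜG`. -/
noncomputable def momentDeriv (R β : ℝ) (U : ℝ → L2 n) (t : ℝ) : ℝ :=
  ∫ x, U t x * weightDeriv n R β t x

/-- `∫ (∂ₜu G - u ∂ₜG)`. -/
noncomputable def wronskian (R β : ℝ) (U v : ℝ → L2 n) (t : ℝ) : ℝ :=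
  (∫ x, v t x * weight n R β t x) - momentDeriv R β U t

theorem continuousOn_wronskian (h : GlobalSolution p R U v) (hn : n ≠ 0) (β : ℝ) :
    ContinuousOn (wronskian R β U v) (Ici 0) :=
  (h.velocity_support.continuousOn_integral_mul h.velocity_continuous
    (continuous_weight hn R β)).sub
  (h.position_support.continuousOn_integral_mul h.position_continuous
    (continuous_weightDeriv hn R β))

theorem hasDerivAt_moment (h : GlobalSolution p R U v) (hn : n ≠ 0) (β : ℝ) {t : ℝ}
    (ht : 0 < t) :
    HasDerivAt (moment R β U) (wronskian R β U v t + 2 * momentDeriv R β U t) t := by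
  have h1 := h.position_support.hasDerivAt_integral_mul h.position_continuous
    (continuous_weight hn R β) (continuous_weightDeriv hn R β)
    (hasDerivAt_shift_waveAvg hn (contDiff_profile β) (R + 1)) ht
    (h.position_support.hasDerivAt_integral_mul_const h.velocity_support ht (h.hasDerivAt t ht)
      (continuous_weight_apply hn R β t))
  refine h1.congr_deriv ?_
  rw [wronskian, momentDeriv]
  ring

/-- Green's identity in time: the terms ∫ u_t G_t cancel, and so do ∫ u ΔG and ∫ u G_tt because G
solves the linear equation. Only the nonlinearity survives. -/
theorem hasDerivAt_wronskian (h : GlobalSolution p R U v) (hR : 0 < R) (hp : 0 < p) (hn : n ≠ 0)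
    (β : ℝ) {t : ℝ} (ht : 0 < t) :
    HasDerivAt (wronskian R β U v) (∫ x, |U t x| ^ p * weight n R β t x) t := by
  have hh := contDiff_profile β
  have h1 := h.velocity_support.hasDerivAt_integral_mul h.velocity_continuous
    (continuous_weight hn R β) (continuous_weightDeriv hn R β)
    (hasDerivAt_shift_waveAvg hn hh (R + 1)) ht
    (h.equation_of_contDiff hR hp (φ := weight n R β t)
      ((contDiff_shift_waveAvg hn hh (R + 1)).comp (contDiff_const.prodMk contDiff_id)) ht)
  have h2 := h.position_support.hasDerivAt_integral_mul h.position_continuous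
    (continuous_weightDeriv hn R β)
    (contDiff_shift_waveAvg hn (contDiff_deriv (contDiff_deriv hh)) (R + 1)).continuous
    (hasDerivAt_shift_waveAvg hn (contDiff_deriv hh) (R + 1)) ht
    (h.position_support.hasDerivAt_integral_mul_const h.velocity_support ht (h.hasDerivAt t ht)
      (continuous_weightDeriv_apply hn R β t))
  have e : ∀ x, Δ (weight n R β t) x
      = waveAvg (sphereMeasure n) (deriv (deriv (profile β))) (t + (R + 1)) x :=
    fun x => laplacian_waveAvg (ae_norm_eq_one_sphereMeasure hn) hh _ x
  simp only [e] at h1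
  refine (h1.sub h2).congr_deriv ?_
  ring

end GlobalSolution

/-! ### Averaging over time intervals [τ, 2τ] -/

theorem rpow_inv_le_add {p y ε : ℝ} (hp : 1 < p) (hy : 0 ≤ y) (hε : 0 < ε) :
    y ^ (1 / p) ≤ ε * y + ε ^ (-(1 / (p - 1))) := by
  have hp0 : 0 < p := by linarith
  have hp1 : 0 < p - 1 := by linarith
  rcases le_or_gt (y ^ (1 / p)) (ε * y) with h | h
  · have := Real.rpow_pos_of_pos hε (-(1 / (p - 1)))
    linarith
  · have hy0 : 0 < y := by
      rcases hy.eq_or_lt with rfl | h0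
      · rw [Real.zero_rpow (by positivity), mul_zero] at h
        exact absurd h (lt_irrefl _)
      · exact h0
    have h1 : y ^ ((p - 1) / p) ≤ ε⁻¹ := by
      have e : y = y ^ (1 / p) * y ^ ((p - 1) / p) := by
        rw [← Real.rpow_add hy0, show 1 / p + (p - 1) / p = 1 by field_simp; ring, Real.rpow_one]
      have hz := Real.rpow_pos_of_pos hy0 (1 / p)
      rw [le_inv_comm₀ (by positivity) hε, ← one_div, le_div_iff₀ (by positivity)]
      have h' : ε * (y ^ (1 / p) * y ^ ((p - 1) / p)) < y ^ (1 / p) := by rwa [← e]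
      by_contra hc
      have := mul_lt_mul_of_pos_left (not_le.1 hc) hz
      linarith
    have h2 : y ^ (1 / p) ≤ ε ^ (-(1 / (p - 1))) := by
      calc y ^ (1 / p) = (y ^ ((p - 1) / p)) ^ (1 / (p - 1)) := by
            rw [← Real.rpow_mul hy]
            congr 1
            field_simp
        _ ≤ (ε⁻¹) ^ (1 / (p - 1)) := Real.rpow_le_rpow (by positivity) h1 (by positivity)
        _ = _ := by rw [Real.inv_rpow hε.le, Real.rpow_neg hε.le]
    have := mul_nonneg hε.le hy
    linarith

/-- The two terms balance at ε = (V/τ)^(-(p-1)/p). As V may vanish, this is done for V' > V, and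
then V' tends to V. -/
theorem le_of_forall_young {p Y A V τ : ℝ} (hp : 1 < p) (hA : 0 ≤ A) (hV : 0 ≤ V) (hτ : 0 < τ)
    (h : ∀ ε, 0 < ε → Y ≤ A * (ε * V + ε ^ (-(1 / (p - 1))) * τ)) :
    Y ≤ 2 * A * τ * (V / τ) ^ (1 / p) := by
  have hp0 : 0 < p := by linarith
  have hp1 : p - 1 ≠ 0 := by linarith
  have key : ∀ V', V < V' → Y ≤ 2 * A * τ * (V' / τ) ^ (1 / p) := by
    intro V' hV'
    have hpos : 0 < V' / τ := div_pos (hV.trans_lt hV') hτ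
    have h1 := h ((V' / τ) ^ (-((p - 1) / p))) (by positivity)
    have e1 : ((V' / τ) ^ (-((p - 1) / p))) ^ (-(1 / (p - 1))) = (V' / τ) ^ (1 / p) := by
      rw [← Real.rpow_mul hpos.le]
      congr 1
      field_simp
    have e2 : (V' / τ) ^ (-((p - 1) / p)) * V' = τ * (V' / τ) ^ (1 / p) := by
      have : V' = τ * (V' / τ) := by field_simp
      nth_rewrite 2 [this]
      rw [mul_left_comm]
      congr 1
      nth_rewrite 2 [← Real.rpow_one (V' / τ)]
      rw [← Real.rpow_add hpos]
      congr 1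
      field_simp
      ring
    rw [e1] at h1
    refine h1.trans ?_
    have : (V' / τ) ^ (-((p - 1) / p)) * V ≤ τ * (V' / τ) ^ (1 / p) := by
      rw [← e2]; gcongr
    calc A * ((V' / τ) ^ (-((p - 1) / p)) * V + (V' / τ) ^ (1 / p) * τ)
        ≤ A * (τ * (V' / τ) ^ (1 / p) + (V' / τ) ^ (1 / p) * τ) := by gcongr
      _ = _ := by ring
  have hc : ContinuousAt (fun V' => 2 * A * τ * (V' / τ) ^ (1 / p)) V := by
    refine continuousAt_const.mul (ContinuousAt.rpow_const (by fun_prop) (Or.inr (by positivity)))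
  exact ge_of_tendsto (hc.tendsto.mono_left nhdsWithin_le_nhds : Tendsto _ (𝓝[>] V) _)
    (by filter_upwards [self_mem_nhdsWithin] with V' hV' using key V' hV')

/-- The time cutoff on `[τ, 2τ]`. -/
noncomputable def cutoff (m : ℕ) (τ t : ℝ) : ℝ := (2 - t / τ) ^ m - (2 - t / τ) ^ (m + 1)

/-- The primitive of `-cutoff / τ` that vanishes at `2τ`. -/
noncomputable def cutoffTail (m : ℕ) (τ t : ℝ) : ℝ :=
  (2 - t / τ) ^ (m + 1) / (m + 1) - (2 - t / τ) ^ (m + 2) / (m + 2)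

theorem hasDerivAt_two_sub_div (τ t : ℝ) : HasDerivAt (fun t => 2 - t / τ) (-τ⁻¹) t := by
  simpa using ((hasDerivAt_id t).div_const τ).const_sub 2

theorem hasDerivAt_cutoff (m : ℕ) (τ t : ℝ) : HasDerivAt (cutoff m τ)
    (-τ⁻¹ * (m * (2 - t / τ) ^ (m - 1) - (m + 1) * (2 - t / τ) ^ m)) t := by
  have h := hasDerivAt_two_sub_div τ t
  refine ((h.pow m).sub (h.pow (m + 1))).congr_deriv ?_
  simp
  ring

theorem hasDerivAt_cutoffTail (m : ℕ) (τ t : ℝ) :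
    HasDerivAt (cutoffTail m τ) (-(cutoff m τ t / τ)) t := by
  have h := hasDerivAt_two_sub_div τ t
  refine (((h.pow (m + 1)).div_const ((m : ℝ) + 1)).sub
    ((h.pow (m + 2)).div_const ((m : ℝ) + 2))).congr_deriv ?_
  simp [cutoff]
  field_simp
  ring

theorem continuous_cutoff (m : ℕ) (τ : ℝ) : Continuous (cutoff m τ) := by
  unfold cutoff; fun_prop

theorem cutoff_left {m : ℕ} {τ : ℝ} (hτ : 0 < τ) : cutoff m τ τ = 0 := by
  simp [cutoff, hτ.ne']; norm_num

theorem cutoff_right {m : ℕ} {τ : ℝ} (hm : m ≠ 0) (hτ : 0 < τ) : cutoff m τ (2 * τ) = 0 := by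
  simp [cutoff, hτ.ne', hm]

theorem cutoffTail_right {m : ℕ} {τ : ℝ} (hτ : 0 < τ) : cutoffTail m τ (2 * τ) = 0 := by
  simp [cutoffTail, hτ.ne']

theorem cutoffTail_left {m : ℕ} {τ : ℝ} (hτ : 0 < τ) :
    cutoffTail m τ τ = 1 / ((m + 1) * (m + 2)) := by
  have : (2 : ℝ) - τ / τ = 1 := by rw [div_self hτ.ne']; norm_num
  rw [cutoffTail, this]
  field_simp
  ring

theorem two_sub_div_mem {τ t : ℝ} (hτ : 0 < τ) (ht : t ∈ Icc τ (2 * τ)) :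
    2 - t / τ ∈ Icc (0 : ℝ) 1 := by
  have h1 : 1 ≤ t / τ := (one_le_div hτ).2 ht.1
  have h2 : t / τ ≤ 2 := (div_le_iff₀ hτ).2 ht.2
  exact ⟨by linarith, by linarith⟩

theorem cutoff_nonneg {m : ℕ} {τ t : ℝ} (hτ : 0 < τ) (ht : t ∈ Icc τ (2 * τ)) :
    0 ≤ cutoff m τ t := by
  have h := two_sub_div_mem hτ ht
  exact sub_nonneg.2 (pow_le_pow_of_le_one h.1 h.2 (Nat.le_succ m))

theorem integral_cutoff {m : ℕ} {τ : ℝ} (hτ : 0 < τ) :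
    ∫ t in τ..(2 * τ), cutoff m τ t = τ * cutoffTail m τ τ := by
  have h := intervalIntegral.integral_eq_sub_of_hasDerivAt (a := τ) (b := 2 * τ)
    (f := fun t => -τ * cutoffTail m τ t) (f' := cutoff m τ)
    (fun t _ => ((hasDerivAt_cutoffTail m τ t).const_mul (-τ)).congr_deriv (by field_simp))
    ((continuous_cutoff m τ).intervalIntegrable _ _)
  rw [h, cutoffTail_right hτ]
  ring

section Averaging

variable {m : ℕ} {τ : ℝ} {f : ℝ → ℝ}

theorem intervalIntegrable_cutoff_mul (hτ : 0 < τ) (hf : ContinuousOn f (Ioi 0)) :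
    IntervalIntegrable (fun t => cutoff m τ t * f t) volume τ (2 * τ) := by
  refine ContinuousOn.intervalIntegrable_of_Icc (by linarith)
    ((continuous_cutoff m τ).continuousOn.mul (hf.mono fun t ht => ?_))
  exact hτ.trans_le ht.1

theorem le_integral_cutoff_mul (hτ : 0 < τ) (hf : ContinuousOn f (Ioi 0)) {c : ℝ}
    (hc : ∀ t ∈ Icc τ (2 * τ), c ≤ f t) :
    cutoffTail m τ τ * c ≤ (∫ t in τ..(2 * τ), cutoff m τ t * f t) / τ := by
  rw [le_div_iff₀ hτ]
  calc cutoffTail m τ τ * c * τ = ∫ t in τ..(2 * τ), cutoff m τ t * c := by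
        rw [intervalIntegral.integral_mul_const, integral_cutoff hτ]; ring
    _ ≤ _ := intervalIntegral.integral_mono_on (by linarith)
        (((continuous_cutoff m τ).intervalIntegrable _ _).mul_const c)
        (intervalIntegrable_cutoff_mul hτ hf)
        fun t ht => mul_le_mul_of_nonneg_left (hc t ht) (cutoff_nonneg hτ ht)

theorem integral_cutoff_mul_le (hτ : 0 < τ) (hf : ContinuousOn f (Ioi 0)) {c : ℝ}
    (hc : ∀ t ∈ Icc τ (2 * τ), f t ≤ c) :
    (∫ t in τ..(2 * τ), cutoff m τ t * f t) / τ ≤ cutoffTail m τ τ * c := by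
  rw [div_le_iff₀ hτ]
  calc _ ≤ ∫ t in τ..(2 * τ), cutoff m τ t * c := intervalIntegral.integral_mono_on (by linarith)
        (intervalIntegrable_cutoff_mul hτ hf)
        (((continuous_cutoff m τ).intervalIntegrable _ _).mul_const c)
        fun t ht => mul_le_mul_of_nonneg_left (hc t ht) (cutoff_nonneg hτ ht)
    _ = _ := by rw [intervalIntegral.integral_mul_const, integral_cutoff hτ]; ring

theorem hasDerivAt_integral_cutoff_mul (hτ : 0 < τ) (hf : ContinuousOn f (Ioi 0)) {t : ℝ}
    (ht : t ∈ Icc τ (2 * τ)) :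
    HasDerivAt (fun t => ∫ s in τ..t, cutoff m τ s * f s) (cutoff m τ t * f t) t := by
  have ht0 : t ∈ Ioi (0 : ℝ) := hτ.trans_le ht.1
  have hc : ContinuousOn (fun t => cutoff m τ t * f t) (Ioi 0) :=
    (continuous_cutoff m τ).continuousOn.mul hf
  refine intervalIntegral.integral_hasDerivAt_right ?_
    (hc.stronglyMeasurableAtFilter isOpen_Ioi t ht0) (hc.continuousAt (Ioi_mem_nhds ht0))
  exact (hc.mono fun s hs => hτ.trans_le hs.1).intervalIntegrable_of_Icc ht.1

/-- With r = 2 - t/τ ∈ [0,1], the cutoff and τ times its derivative are O(r^(m-1)), while the tail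
is at least a multiple of r^(m+1). The condition m + 1 ≤ (m-1)p makes r^(m-1) at most
(r^(m+1))^(1/p), so the error terms are absorbed by tail^(1/p). -/
theorem cutoff_bound {p K y : ℝ} (hp : 1 < p) (hm : ((m : ℝ) + 1) ≤ (m - 1) * p) (hm1 : 1 ≤ m)
    (hτ : 0 < τ) (hK : 0 ≤ K) (hy : 0 ≤ y) {t M H : ℝ} (ht : t ∈ Icc τ (2 * τ))
    (hM : |M| ≤ τ * (K * y ^ (1 / p))) (hH : |H| ≤ K * y ^ (1 / p)) :
    -((-τ⁻¹ * (m * (2 - t / τ) ^ (m - 1) - (m + 1) * (2 - t / τ) ^ m)) * M)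
        - 2 * (cutoff m τ t * H)
      ≤ (2 * m + 3) * ((m + 1) * (m + 2)) * K * (cutoffTail m τ t * y) ^ (1 / p) := by
  have hp0 : 0 < p := by linarith
  set q := 2 - t / τ with hq
  obtain ⟨hq0, hq1⟩ : q ∈ Icc (0 : ℝ) 1 := two_sub_div_mem hτ ht
  set Z := K * y ^ (1 / p) with hZ
  have hZ0 : 0 ≤ Z := by positivity
  have hqm : q ^ m ≤ q ^ (m - 1) := pow_le_pow_of_le_one hq0 hq1 (Nat.sub_le m 1)
  have hqm0 : 0 ≤ q ^ m := by positivity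
  have hqm1 : 0 ≤ q ^ (m + 1) := by positivity
  have hm0 : (0 : ℝ) ≤ m := Nat.cast_nonneg m
  have h1 : |(-τ⁻¹ * (m * q ^ (m - 1) - (m + 1) * q ^ m)) * M| ≤ (2 * m + 1) * q ^ (m - 1) * Z := by
    rw [abs_mul, abs_mul, abs_neg, abs_of_pos (inv_pos.2 hτ)]
    have hA : |m * q ^ (m - 1) - (m + 1) * q ^ m| ≤ (2 * m + 1) * q ^ (m - 1) := by
      rw [abs_le]
      constructor <;> nlinarith
    calc τ⁻¹ * |m * q ^ (m - 1) - (m + 1) * q ^ m| * |M|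
        ≤ τ⁻¹ * ((2 * m + 1) * q ^ (m - 1)) * (τ * Z) := by gcongr
      _ = _ := by field_simp
  have h2 : |2 * (cutoff m τ t * H)| ≤ 2 * q ^ (m - 1) * Z := by
    rw [abs_mul, abs_mul, abs_two, abs_of_nonneg (cutoff_nonneg hτ ht), ← mul_assoc]
    gcongr
    rw [cutoff, ← hq]
    linarith
  have h3 : q ^ (m - 1) ≤ ((m + 1) * (m + 2)) * (cutoffTail m τ t) ^ (1 / p) := by
    have hw : q ^ (m + 1) ≤ ((m + 1) * (m + 2)) * cutoffTail m τ t := by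
      rw [cutoffTail, ← hq]
      have : q ^ (m + 2) ≤ q ^ (m + 1) := pow_le_pow_of_le_one hq0 hq1 (Nat.le_succ _)
      have e : (((m : ℝ) + 1) * (m + 2)) * (q ^ (m + 1) / (m + 1) - q ^ (m + 2) / (m + 2))
          = (m + 2) * q ^ (m + 1) - (m + 1) * q ^ (m + 2) := by field_simp
      rw [e]
      nlinarith
    have hw0 : 0 ≤ cutoffTail m τ t := by
      by_contra hc
      have : ((m : ℝ) + 1) * (m + 2) * cutoffTail m τ t < 0 :=
        mul_neg_of_pos_of_neg (by positivity) (not_le.1 hc)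
      linarith
    have hone : (1 : ℝ) ≤ (m + 1) * (m + 2) := by nlinarith
    calc q ^ (m - 1) = (q ^ ((m - 1 : ℕ) * p)) ^ (1 / p) := by
          rw [← Real.rpow_mul hq0, mul_assoc, mul_one_div_cancel hp0.ne', mul_one,
            Real.rpow_natCast]
      _ ≤ (q ^ (m + 1)) ^ (1 / p) := by
          refine Real.rpow_le_rpow (by positivity) ?_ (by positivity)
          rw [← Real.rpow_natCast q (m + 1)]
          refine Real.rpow_le_rpow_of_exponent_ge' hq0 hq1 (by positivity) ?_
          rw [Nat.cast_sub hm1]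
          push_cast
          exact hm
      _ ≤ (((m + 1) * (m + 2)) * cutoffTail m τ t) ^ (1 / p) :=
          Real.rpow_le_rpow (by positivity) hw (by positivity)
      _ = ((m + 1) * (m + 2) : ℝ) ^ (1 / p) * (cutoffTail m τ t) ^ (1 / p) :=
          Real.mul_rpow (by positivity) hw0
      _ ≤ _ := by
          gcongr
          calc ((m + 1) * (m + 2) : ℝ) ^ (1 / p) ≤ ((m + 1) * (m + 2) : ℝ) ^ (1 : ℝ) :=
                Real.rpow_le_rpow_of_exponent_le hone ((div_le_one hp0).2 hp.le)
            _ = _ := Real.rpow_one _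
  have hw0 : 0 ≤ cutoffTail m τ t := by
    rw [cutoffTail, ← hq, sub_nonneg]
    calc q ^ (m + 2) / (m + 2) ≤ q ^ (m + 1) / (m + 2) := by
          gcongr ?_ / _
          exact pow_le_pow_of_le_one hq0 hq1 (Nat.le_succ _)
      _ ≤ q ^ (m + 1) / (m + 1) := by gcongr; linarith
  calc _ ≤ (2 * m + 1) * q ^ (m - 1) * Z + 2 * q ^ (m - 1) * Z := by
        have := neg_abs_le ((-τ⁻¹ * (m * q ^ (m - 1) - (m + 1) * q ^ m)) * M)
        have := neg_abs_le (2 * (cutoff m τ t * H))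
        linarith
    _ = (2 * m + 3) * q ^ (m - 1) * Z := by ring
    _ ≤ (2 * m + 3) * (((m + 1) * (m + 2)) * (cutoffTail m τ t) ^ (1 / p)) * Z := by gcongr
    _ = _ := by rw [hZ, Real.mul_rpow hw0 hy]; ring

/-- Averaging of `M' = N + 2H` against `cutoff`, when `M / τ` and `H` are controlled by a power of
the derivative of `L`. -/
theorem average_le {p K : ℝ} {M N H L a : ℝ → ℝ} (hp : 1 < p)
    (hm : ((m : ℝ) + 1) ≤ (m - 1) * p) (hm1 : 1 ≤ m) (hτ : 0 < τ) (hK : 0 ≤ K)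
    (hN : ContinuousOn N (Ioi 0)) (hMd : ∀ t, 0 < t → HasDerivAt M (N t + 2 * H t) t)
    (hLd : ∀ t, 0 < t → HasDerivAt L (a t) t) (ha : ∀ t, 0 < t → 0 ≤ a t)
    (hM : ∀ t ∈ Icc τ (2 * τ), |M t| ≤ τ * (K * a t ^ (1 / p)))
    (hH : ∀ t ∈ Icc τ (2 * τ), |H t| ≤ K * a t ^ (1 / p))
    (hV : 0 ≤ (∫ t in τ..(2 * τ), cutoff m τ t * L t) / τ - cutoffTail m τ τ * L τ) :
    (∫ t in τ..(2 * τ), cutoff m τ t * N t) / τ ≤ 2 * ((2 * m + 3) * ((m + 1) * (m + 2)) * K) *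
      (((∫ t in τ..(2 * τ), cutoff m τ t * L t) / τ - cutoffTail m τ τ * L τ) / τ) ^ (1 / p) := by
  set B := (2 * m + 3) * (((m : ℝ) + 1) * (m + 2)) * K with hB
  have hB0 : 0 ≤ B := by positivity
  have hL : ContinuousOn L (Ioi 0) := fun t ht => (hLd t ht).continuousAt.continuousWithinAt
  rw [div_le_iff₀ hτ, mul_right_comm]
  -- Young's inequality replaces the power 1/p by an expression linear in `a`, which is the
  -- derivative of L. The estimate then reduces to the monotonicity of Θ, and integrability of `a`
  -- in time is not needed.
  refine le_of_forall_young hp hB0 hV hτ fun ε hε => ?_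
  set Y := ε ^ (-(1 / (p - 1)))
  set Θ : ℝ → ℝ := fun t => cutoff m τ t * M t + B * (ε * (cutoffTail m τ t * L t
    + (∫ s in τ..t, cutoff m τ s * L s) / τ) + Y * t) - ∫ s in τ..t, cutoff m τ s * N s with hΘ
  have hΘd : ∀ t ∈ Icc τ (2 * τ), ∃ d, 0 ≤ d ∧ HasDerivAt Θ d t := by
    intro t ht
    have ht0 : 0 < t := hτ.trans_le ht.1
    have h1 := (hasDerivAt_cutoff m τ t).mul (hMd t ht0)
    have h2 := (hasDerivAt_cutoffTail m τ t).mul (hLd t ht0)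
    have h3 := (hasDerivAt_integral_cutoff_mul (m := m) hτ hL ht).div_const τ
    have h4 := hasDerivAt_integral_cutoff_mul (m := m) hτ hN ht
    have h5 := (h1.add ((((h2.add h3).const_mul ε).add ((hasDerivAt_id t).const_mul Y)).const_mul
      B)).sub h4
    refine ⟨_, ?_, h5⟩
    have hw0 : 0 ≤ cutoffTail m τ t := by
      obtain ⟨hq0, hq1⟩ := two_sub_div_mem hτ ht
      rw [cutoffTail, sub_nonneg]
      gcongr ?_ / ?_
      · exact pow_le_pow_of_le_one hq0 hq1 (Nat.le_succ _)
      · linarith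
    have hb := cutoff_bound hp hm hm1 hτ hK (ha t ht0) ht (hM t ht) (hH t ht)
    have hy := rpow_inv_le_add hp (mul_nonneg hw0 (ha t ht0)) hε
    have := mul_le_mul_of_nonneg_left hy hB0
    have e : B * (ε * (-(cutoff m τ t / τ) * L t + cutoffTail m τ t * a t
        + cutoff m τ t * L t / τ) + Y * 1)
        = B * (ε * (cutoffTail m τ t * a t) + Y) := by ring
    rw [e]
    linarith
  have hmono : MonotoneOn Θ (Icc τ (2 * τ)) := by
    refine monotoneOn_of_deriv_nonneg (convex_Icc _ _) (fun t ht => ?_) (fun t ht => ?_)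
      fun t ht => ?_
    · obtain ⟨d, _, hd⟩ := hΘd t ht
      exact hd.continuousAt.continuousWithinAt
    · obtain ⟨d, _, hd⟩ := hΘd t (interior_subset ht)
      exact hd.differentiableAt.differentiableWithinAt
    · obtain ⟨d, hd0, hd⟩ := hΘd t (interior_subset ht)
      rwa [hd.deriv]
  have := hmono (left_mem_Icc.2 (by linarith)) (right_mem_Icc.2 (by linarith))
    (by linarith : τ ≤ 2 * τ)
  -- The cutoff vanishes at both ends, which removes the boundary values of M; the tail vanishes
  -- only at 2τ, which leaves the term in L τ.
  simp only [hΘ, cutoff_left hτ, cutoff_right (Nat.one_le_iff_ne_zero.1 hm1) hτ,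
    cutoffTail_right hτ, intervalIntegral.integral_same, zero_div, zero_mul, zero_add, add_zero,
    sub_zero] at this
  calc _ ≤ B * (ε * ((∫ t in τ..(2 * τ), cutoff m τ t * L t) / τ) + Y * (2 * τ))
        - B * (ε * (cutoffTail m τ τ * L τ) + Y * τ) := by linarith
    _ = _ := by ring

end Averaging

/-! ### The discrete growth argument -/

/-- The growth conditions that make the averaged functional blow up. -/
theorem false_of_growth {p q c c₀ C : ℝ} (hpq : p.HolderConjugate q) (hc : 0 < c) (hc₀ : 0 < c₀)
    (hC : 0 < C) {L V : ℕ → ℝ} (hL0 : 0 ≤ L 0) (hV0 : ∀ k, c₀ ≤ V k)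
    (hV : ∀ k, V k ≤ C * ((k : ℝ) + 1) ^ (1 / q) * V k ^ (1 / p))
    (hLV : ∀ k, c * L k ≤ C * ((k : ℝ) + 1) ^ (1 / q) * V k ^ (1 / p))
    (hstep : ∀ k, V k ≤ c * (L (k + 1) - L k)) : False := by
  have hp := hpq.pos
  have hq := hpq.symm.pos
  have hsum : 1 / p + 1 / q = 1 := by simpa using hpq.inv_add_inv_eq_one
  have hVp : ∀ k, 0 < V k := fun k => hc₀.trans_le (hV0 k)
  have hk1 : ∀ k : ℕ, (0 : ℝ) < (k : ℝ) + 1 := fun k => by positivity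
  have hlow : ∀ k : ℕ, k * (c₀ / c) ≤ L k := by
    intro k
    induction k with
    | zero => simpa using hL0
    | succ k ih =>
      have h1 : c₀ / c ≤ L (k + 1) - L k :=
        (div_le_iff₀' hc).2 ((hV0 k).trans (hstep k))
      push_cast
      linarith
  -- `hV` bounds V by its own power 1/p < 1; dividing by V^(1/p) leaves V^(1/q).
  have hVup : ∀ k : ℕ, V k ≤ C ^ q * ((k : ℝ) + 1) := by
    intro k
    have e : V k = V k ^ (1 / q) * V k ^ (1 / p) := by
      rw [← Real.rpow_add (hVp k), add_comm, hsum, Real.rpow_one]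
    have h1 : V k ^ (1 / q) ≤ C * ((k : ℝ) + 1) ^ (1 / q) := by
      have hpos := Real.rpow_pos_of_pos (hVp k) (1 / p)
      refine le_of_mul_le_mul_right ?_ hpos
      rw [← e]
      exact hV k
    calc V k = (V k ^ (1 / q)) ^ q := by
          rw [← Real.rpow_mul (hVp k).le, one_div_mul_cancel hq.ne', Real.rpow_one]
      _ ≤ (C * ((k : ℝ) + 1) ^ (1 / q)) ^ q :=
          Real.rpow_le_rpow (Real.rpow_nonneg (hVp k).le _) h1 hq.le
      _ = _ := by
          rw [Real.mul_rpow hC.le (by positivity), ← Real.rpow_mul (hk1 k).le,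
            one_div_mul_cancel hq.ne', Real.rpow_one]
  obtain ⟨D, hD, hLup⟩ : ∃ D : ℝ, 0 < D ∧ ∀ k : ℕ, L k ≤ D * ((k : ℝ) + 1) := by
    refine ⟨C * (C ^ q) ^ (1 / p) / c, by positivity, fun k => ?_⟩
    have h1 : c * L k ≤ C * (C ^ q) ^ (1 / p) * ((k : ℝ) + 1) := by
      calc c * L k ≤ C * ((k : ℝ) + 1) ^ (1 / q) * (C ^ q * ((k : ℝ) + 1)) ^ (1 / p) := by
            refine (hLV k).trans ?_
            gcongr
            · exact (hVp k).le
            · exact hVup k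
        _ = C * (C ^ q) ^ (1 / p) * (((k : ℝ) + 1) ^ (1 / p) * ((k : ℝ) + 1) ^ (1 / q)) := by
            rw [Real.mul_rpow (by positivity) (hk1 k).le]; ring
        _ = _ := by rw [← Real.rpow_add (hk1 k), hsum, Real.rpow_one]
    rw [div_mul_eq_mul_div, le_div_iff₀ hc]
    linarith
  set b := c₀ / (2 * c) with hb
  have hb0 : 0 < b := by positivity
  have hLb : ∀ k : ℕ, 1 ≤ k → b * ((k : ℝ) + 1) ≤ L k := by
    intro k hk
    refine le_trans ?_ (hlow k)
    have hk' : (1 : ℝ) ≤ k := by exact_mod_cast hk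
    have : c₀ / c = 2 * b := by rw [hb]; field_simp
    rw [this]
    nlinarith
  -- `hLV` raised to the power p gives V ≥ (c/C)^p L^p / (k+1)^(p-1), since p/q = p - 1. Bounding
  -- L/(k+1) below by b leaves a multiple of L, and `hstep` divides it by c.
  set θ := (c / C) ^ p * b ^ (p - 1) / c with hθ
  have hθ0 : 0 < θ := by positivity
  have hgrow : ∀ k : ℕ, 1 ≤ k → (1 + θ) * L k ≤ L (k + 1) := by
    intro k hk
    have hLk : 0 < L k := (mul_pos hb0 (hk1 k)).trans_le (hLb k hk)
    have hp1 : p - 1 = p * (1 / q) := by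
      have := hpq.lt; field_simp; linarith [hpq.mul_eq_add]
    have h1 : c / C * L k / ((k : ℝ) + 1) ^ (1 / q) ≤ V k ^ (1 / p) := by
      rw [div_le_iff₀ (by positivity), div_mul_eq_mul_div, div_le_iff₀ hC]
      linarith [hLV k]
    have h2 : (c / C) ^ p * b ^ (p - 1) * L k ≤ V k := by
      calc (c / C) ^ p * b ^ (p - 1) * L k
          ≤ (c / C) ^ p * (L k / ((k : ℝ) + 1)) ^ (p - 1) * L k := by
            gcongr
            · linarith [hpq.lt]
            · exact (le_div_iff₀ (hk1 k)).2 (hLb k hk)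
        _ = (c / C * L k / ((k : ℝ) + 1) ^ (1 / q)) ^ p := by
            rw [Real.div_rpow (x := c / C * L k) (by positivity) (by positivity),
              Real.mul_rpow (x := c / C) (by positivity) hLk.le,
              Real.div_rpow hLk.le (hk1 k).le, ← Real.rpow_mul (hk1 k).le, mul_comm (1 / q) p,
              ← hp1, Real.rpow_sub_one hLk.ne']
            field_simp
        _ ≤ (V k ^ (1 / p)) ^ p := Real.rpow_le_rpow (by positivity) h1 hp.le
        _ = V k := by
            rw [← Real.rpow_mul (hVp k).le, one_div_mul_cancel hp.ne', Real.rpow_one]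
    have h3 : θ * L k ≤ L (k + 1) - L k := by
      rw [hθ, div_mul_eq_mul_div, div_le_iff₀ hc]
      linarith [hstep k]
    linarith
  have hexp : ∀ k : ℕ, (1 + θ) ^ k * b ≤ L (k + 1) := by
    intro k
    induction k with
    | zero =>
      have := hLb 1 le_rfl
      simp only [pow_zero, one_mul]
      push_cast at this
      linarith
    | succ k ih =>
      calc (1 + θ) ^ (k + 1) * b = (1 + θ) * ((1 + θ) ^ k * b) := by ring
        _ ≤ (1 + θ) * L (k + 1) := by gcongr
        _ ≤ _ := hgrow (k + 1) (by omega)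
  -- The linear upper bound at k + 1 is D(k+2) ≤ 3Dk for k ≥ 1, and this loses to b(1+θ)^k.
  have hlim := (tendsto_pow_const_div_const_pow_of_one_lt 1 (by linarith : 1 < 1 + θ)).const_mul
    (3 * D)
  rw [mul_zero] at hlim
  obtain ⟨k, hk, hk'⟩ := ((hlim.eventually_lt_const hb0).and (eventually_ge_atTop 1)).exists
  have h1 := (hexp k).trans (hLup (k + 1))
  have hkr : (1 : ℝ) ≤ k := by exact_mod_cast hk'
  rw [pow_one, mul_div_assoc', div_lt_iff₀ (by positivity)] at hk
  push_cast at h1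
  nlinarith

/-! ### The critical exponent and the critical Hölder estimate -/

section Exponents

variable {p : ℝ}

/-- The quadratic equation divided by 2p: the form in which criticality enters the balance of powers
of time. -/
theorem IsCriticalExponent.mul_eq (hp : IsCriticalExponent n p) :
    ((n : ℝ) - 1) / 2 * p = ((n : ℝ) - 1) / 2 + 1 + 1 / p := by
  have h0 := hp.1
  have := hp.2
  field_simp
  linarith

theorem IsCriticalExponent.one_lt (hp : IsCriticalExponent n p) (hn : 2 ≤ n) : 1 < p := by
  have h0 := hp.1
  have h := hp.mul_eq
  have hn' : (2 : ℝ) ≤ n := by exact_mod_cast hn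
  have : 0 < 1 / p := by positivity
  by_contra hc
  have hk : 0 < ((n : ℝ) - 1) / 2 := by linarith
  nlinarith

theorem IsCriticalExponent.inv_lt (hp : IsCriticalExponent n p) (hn : 2 ≤ n) :
    1 / p < ((n : ℝ) - 1) / 2 := by
  have h0 := hp.1
  have h := hp.mul_eq
  have hn' : (2 : ℝ) ≤ n := by exact_mod_cast hn
  have : 0 < 1 / p := by positivity
  rw [div_lt_iff₀ h0]
  linarith

end Exponents

namespace GlobalSolution

variable {p q R : ℝ} {U v : ℝ → L2 n}

/-- `∫ |u|^p G`, the derivative of `wronskian`. -/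
noncomputable def source (p R β : ℝ) (U : ℝ → L2 n) (t : ℝ) : ℝ :=
  ∫ x, |U t x| ^ p * weight n R β t x

theorem weight_pos (hn : n ≠ 0) {β t : ℝ} (hβ : 0 ≤ β) {x : Space n} (hx : ‖x‖ ≤ t + R) :
    0 < weight n R β t x :=
  waveAvg_profile_pos hn hβ (by linarith)

theorem ae_norm_le (h : GlobalSolution p R U v) {t : ℝ} (ht : 0 ≤ t) :
    ∀ᵐ x, t + R < ‖x‖ → U t x = 0 := by
  filter_upwards [h.position_support t ht] with x hx hlt
  exact hx fun hm => absurd (mem_closedBall_zero_iff.1 hm) (not_le.2 hlt)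

theorem source_nonneg (h : GlobalSolution p R U v) (hp : 0 < p) (hn : n ≠ 0) {β t : ℝ}
    (hβ : 0 ≤ β) (ht : 0 ≤ t) : 0 ≤ source p R β U t := by
  refine integral_nonneg_of_ae ?_
  filter_upwards [h.ae_norm_le ht] with x hx
  rcases le_or_gt ‖x‖ (t + R) with h1 | h1
  · exact mul_nonneg (Real.rpow_nonneg (abs_nonneg _) _) (weight_pos hn hβ h1).le
  · simp [hx h1, Real.zero_rpow hp.ne']

theorem integral_rpow_le_source (h : GlobalSolution p R U v) (hp : 0 < p) (hR : 0 < R)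
    (hn : n ≠ 0) {β : ℝ} (hβ : 0 ≤ β) :
    ∃ C : ℝ, 0 < C ∧ ∀ t, 0 ≤ t →
      ∫ x, |U t x| ^ p ≤ C * (t + (R + 1)) ^ β * source p R β U t := by
  set A := (sphereMeasure n).real univ
  have hA : 0 < A := sphereMeasure_real_univ_pos
  -- In the cone the phase is at most 2T, so every plane wave is at least (1+4T²)^(-β/2), and 1 +
  -- 4T² ≤ 5T² because T ≥ 1.
  refine ⟨5 ^ (β / 2) / A, by positivity, fun t ht => ?_⟩
  set T := t + (R + 1) with hT
  have hT1 : 1 ≤ T := by linarith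
  have hT0 : 0 < T := by linarith
  have hlow : ∀ x : Space n, ‖x‖ ≤ t + R → 1 ≤ 5 ^ (β / 2) / A * T ^ β * weight n R β t x := by
    intro x hx
    have h1 := le_waveAvg_profile hn hβ (x := x) (T := T) (by linarith)
    have h2 : (5 * T ^ 2) ^ (-β / 2) ≤ (1 + (2 * T) ^ 2) ^ (-β / 2) :=
      Real.rpow_le_rpow_of_nonpos (by positivity) (by nlinarith) (by linarith)
    have h3 : (5 * T ^ 2) ^ (-β / 2) = (5 ^ (β / 2) * T ^ β)⁻¹ := by
      rw [Real.mul_rpow (by norm_num) (by positivity), ← Real.rpow_natCast, ← Real.rpow_mul hT0.le,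
        mul_inv, ← Real.rpow_neg (by norm_num), ← Real.rpow_neg hT0.le]
      congr 2
      · ring
      · push_cast; ring
    have h4 : A * (5 ^ (β / 2) * T ^ β)⁻¹ ≤ weight n R β t x := by
      rw [← h3]
      exact (mul_le_mul_of_nonneg_left h2 hA.le).trans h1
    calc (1 : ℝ) = 5 ^ (β / 2) / A * T ^ β * (A * (5 ^ (β / 2) * T ^ β)⁻¹) := by field_simp
      _ ≤ _ := by gcongr
  rw [source, ← integral_const_mul]
  refine integral_mono_ae (h.integrable_rpow hp ht)
    ((h.integrable_rpow_mul hp ht (continuous_weight_apply hn R β t)).const_mul _) ?_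
  filter_upwards [h.ae_norm_le ht] with x hx
  rcases le_or_gt ‖x‖ (t + R) with h1 | h1
  · have := mul_le_mul_of_nonneg_left (hlow x h1) (Real.rpow_nonneg (abs_nonneg (U t x)) p)
    linarith
  · simp [hx h1, Real.zero_rpow hp.ne']

/-- Hölder's inequality in space at the critical exponent. -/
theorem exists_moment_le (h : GlobalSolution p R U v) (hpq : p.HolderConjugate q)
    (hcrit : IsCriticalExponent n p) (hR : 0 < R) (hn : 2 ≤ n) {a : ℝ} (ha : 0 < a)
    (hβ : 0 < ((n : ℝ) - 1) / 2 + a / q - 1) :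
    ∃ C : ℝ, 0 < C ∧ ∀ τ, 1 ≤ τ → ∀ t ∈ Icc τ (2 * τ),
      |moment R (((n : ℝ) - 1) / 2 + a / q - 1) U t| ≤
        τ * (C * τ ^ (1 / p) * (∫ s in 1..((R + 3) * τ), s ^ (-a)) ^ (1 / q) *
          source p R (((n : ℝ) - 1) / 2 - 1 / p) U t ^ (1 / p)) ∧
      |momentDeriv R (((n : ℝ) - 1) / 2 + a / q - 1) U t| ≤
        C * τ ^ (1 / p) * (∫ s in 1..((R + 3) * τ), s ^ (-a)) ^ (1 / q) *
          source p R (((n : ℝ) - 1) / 2 - 1 / p) U t ^ (1 / p) := by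
  have hn0 : n ≠ 0 := by omega
  have hp := hpq.pos
  have hq := hpq.symm.pos
  set κ := ((n : ℝ) - 1) / 2 with hκ
  set β := κ + a / q - 1 with hβdef
  have hβ₁ : 0 < κ - 1 / p := by linarith [hcrit.inv_lt hn]
  have haq : 0 < a / q := by positivity
  obtain ⟨C₀, hC₀, hw⟩ := exists_waveAvg_profile_le hn0 hβ (by linarith)
  obtain ⟨C₁, hC₁, hs⟩ := h.integral_rpow_le_source hp hR hn0 hβ₁.le
  set A := (n : ℝ) * volume.real (ball (0 : Space n) 1)
  have hA : 0 ≤ A := by positivity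
  set C₂ := C₀ * C₁ ^ (1 / p) * A ^ (1 / q) * (R + 3) ^ (1 / p)
  have hC₂ : 0 ≤ C₂ := by positivity
  have hJ0 : ∀ {T : ℝ}, 1 ≤ T → 0 ≤ ∫ s in 1..T, s ^ (-a) := fun hT =>
    intervalIntegral.integral_nonneg hT fun s hs => Real.rpow_nonneg (by linarith [hs.1]) _
  refine ⟨(R + 3) * C₂ + 1, by positivity, fun τ hτ t ht => ?_⟩
  have ht0 : 0 ≤ t := by linarith [ht.1]
  set T := t + (R + 1) with hT
  have hT1 : 1 ≤ T := by linarith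
  have hT0 : 0 < T := by linarith
  have hTτ : T ≤ (R + 3) * τ := by nlinarith [ht.2]
  have hτ0 : 0 < τ := by linarith
  set S := source p R (κ - 1 / p) U t
  have hS0 : 0 ≤ S := h.source_nonneg hp hn0 hβ₁.le ht0
  set J := ∫ s in 1..((R + 3) * τ), s ^ (-a)
  have hJ : ∫ s in 1..T, s ^ (-a) ≤ J := by
    refine intervalIntegral.integral_mono_interval le_rfl hT1 hTτ ?_ ?_
    · exact (ae_restrict_mem measurableSet_Ioc).mono fun s hs =>
        Real.rpow_nonneg (by linarith [hs.1]) _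
    · refine ContinuousOn.intervalIntegrable_of_Icc (hT1.trans hTτ) fun s hs => ?_
      exact (Real.continuousAt_rpow_const _ _ (Or.inl (by linarith [hs.1]))).continuousWithinAt
  have hJ1 : 0 ≤ J := hJ0 (hT1.trans hTτ)
  have hexp : κ - (β + 1) = -a / q := by rw [hβdef]; ring
  rw [hexp] at hw
  set I := (∫ x, |U t x| ^ p) ^ (1 / p) * (A * T ^ ((n : ℝ) - 1) * ∫ s in 1..T, s ^ (-a)) ^ (1 / q)
    with hI
  have hsupp : ∀ᵐ x, T - 1 < ‖x‖ → U t x = 0 := by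
    have := h.ae_norm_le ht0
    rwa [show T - 1 = t + R by rw [hT]; ring]
  have hmeas : AEStronglyMeasurable (U t : Space n → ℝ) := Lp.aestronglyMeasurable _
  have b1 : |moment R β U t| ≤ T * (C₀ * T ^ (-κ)) * I :=
    abs_integral_mul_le_of_cone hpq hn0 hT1 (by positivity) hmeas (h.integrable_rpow hp ht0)
      hsupp fun x hx => by
        have := (hw T x (by linarith)).1
        rwa [← mul_assoc] at this
  have b2 : |momentDeriv R β U t| ≤ C₀ * T ^ (-κ) * I :=
    abs_integral_mul_le_of_cone hpq hn0 hT1 (by positivity) hmeas (h.integrable_rpow hp ht0)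
      hsupp fun x hx => (hw T x (by linarith)).2
  have hIle : C₀ * T ^ (-κ) * I ≤ C₂ * τ ^ (1 / p) * J ^ (1 / q) * S ^ (1 / p) := by
    -- The powers of T come from the decay of the averaged waves, from comparing ∫ |u|^p with the
    -- source, and from the volume of the ball. Their sum equals 1/p exactly because p is critical.
    have e : -κ + (κ - 1 / p) * (1 / p) + ((n : ℝ) - 1) * (1 / q) = 1 / p := by
      have h1 : 1 / q = 1 - 1 / p := by
        have := hpq.inv_add_inv_eq_one
        rw [one_div, one_div]; linarith
      have h2 := hcrit.mul_eq
      rw [← hκ] at h2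
      have h3 : (n : ℝ) - 1 = 2 * κ := by rw [hκ]; ring
      have h4 : κ = (κ + 1 + 1 / p) * (1 / p) := by
        rw [← h2]; field_simp
      rw [h1, h3]
      linarith
    have i1 : (∫ x, |U t x| ^ p) ^ (1 / p)
        ≤ C₁ ^ (1 / p) * T ^ ((κ - 1 / p) * (1 / p)) * S ^ (1 / p) := by
      refine (Real.rpow_le_rpow (integral_nonneg fun x => Real.rpow_nonneg (abs_nonneg _) _)
        (hs t ht0) (by positivity)).trans (le_of_eq ?_)
      rw [Real.mul_rpow (by positivity) hS0, Real.mul_rpow hC₁.le (by positivity),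
        ← Real.rpow_mul hT0.le]
    have i2 : (A * T ^ ((n : ℝ) - 1) * ∫ s in 1..T, s ^ (-a)) ^ (1 / q)
        ≤ A ^ (1 / q) * T ^ (((n : ℝ) - 1) * (1 / q)) * J ^ (1 / q) := by
      have : 0 ≤ ∫ s in 1..T, s ^ (-a) := hJ0 hT1
      refine (Real.rpow_le_rpow (by positivity) (mul_le_mul_of_nonneg_left hJ (by positivity))
        (by positivity)).trans (le_of_eq ?_)
      rw [Real.mul_rpow (by positivity) hJ1, Real.mul_rpow hA (by positivity),
        ← Real.rpow_mul hT0.le]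
    have : 0 ≤ ∫ s in 1..T, s ^ (-a) := hJ0 hT1
    calc C₀ * T ^ (-κ) * I
        ≤ C₀ * T ^ (-κ) * ((C₁ ^ (1 / p) * T ^ ((κ - 1 / p) * (1 / p)) * S ^ (1 / p)) *
            (A ^ (1 / q) * T ^ (((n : ℝ) - 1) * (1 / q)) * J ^ (1 / q))) := by
          rw [hI]
          gcongr
      _ = C₀ * C₁ ^ (1 / p) * A ^ (1 / q) * (T ^ (-κ) * T ^ ((κ - 1 / p) * (1 / p)) *
            T ^ (((n : ℝ) - 1) * (1 / q))) * J ^ (1 / q) * S ^ (1 / p) := by ring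
      _ = C₀ * C₁ ^ (1 / p) * A ^ (1 / q) * T ^ (1 / p) * J ^ (1 / q) * S ^ (1 / p) := by
          rw [← Real.rpow_add hT0, ← Real.rpow_add hT0, e]
      _ ≤ C₀ * C₁ ^ (1 / p) * A ^ (1 / q) * ((R + 3) * τ) ^ (1 / p) * J ^ (1 / q) *
            S ^ (1 / p) := by gcongr
      _ = _ := by
          rw [Real.mul_rpow (by positivity) hτ0.le]
          simp only [C₂]
          ring
  set Z := τ ^ (1 / p) * J ^ (1 / q) * S ^ (1 / p) with hZ
  have hZ0 : 0 ≤ Z := by positivity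
  have hIle' : C₀ * T ^ (-κ) * I ≤ C₂ * Z := hIle.trans (le_of_eq (by rw [hZ]; ring))
  have e' : ((R + 3) * C₂ + 1) * τ ^ (1 / p) * J ^ (1 / q) * S ^ (1 / p)
      = ((R + 3) * C₂ + 1) * Z := by rw [hZ]; ring
  rw [e']
  constructor
  · calc |moment R β U t| ≤ T * (C₀ * T ^ (-κ)) * I := b1
      _ = T * (C₀ * T ^ (-κ) * I) := by ring
      _ ≤ ((R + 3) * τ) * (C₂ * Z) :=
          mul_le_mul hTτ hIle' ((abs_nonneg _).trans b2) (by positivity)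
      _ ≤ τ * (((R + 3) * C₂ + 1) * Z) := by nlinarith [mul_nonneg hτ0.le hZ0]
  · calc |momentDeriv R β U t| ≤ C₂ * Z := b2.trans hIle'
      _ ≤ ((R + 3) * C₂ + 1) * Z := by
          gcongr
          nlinarith [mul_nonneg hR.le hC₂]

/-- On the support of the data G > 0 and G_t < 0, so both parts of the Wronskian are nonnegative. If
their sum vanished, both data would vanish almost everywhere. -/
theorem wronskian_zero_pos (h : GlobalSolution p R U v) (hn : n ≠ 0) {β : ℝ} (hβ : 0 < β)
    (hU : ∀ᵐ x, 0 ≤ U 0 x) (hv : ∀ᵐ x, 0 ≤ v 0 x) (hne : U 0 ≠ 0 ∨ v 0 ≠ 0) :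
    0 < wronskian R β U v 0 := by
  have hsuppU := h.ae_norm_le le_rfl
  have hsuppv : ∀ᵐ x, 0 + R < ‖x‖ → v 0 x = 0 := by
    filter_upwards [h.velocity_support 0 le_rfl] with x hx hlt
    exact hx fun hm => absurd (mem_closedBall_zero_iff.1 hm) (not_le.2 hlt)
  have hneg : ∀ x : Space n, ‖x‖ ≤ 0 + R → weightDeriv n R β 0 x < 0 := fun x hx =>
    waveAvg_deriv_profile_neg hn hβ (by linarith)
  have hi1 := h.velocity_support.integrable le_rfl (continuous_weight_apply hn R β 0)
  have hi2 := h.position_support.integrable le_rfl (continuous_weightDeriv_apply hn R β 0)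
  have h1 : 0 ≤ᵐ[volume] fun x => v 0 x * weight n R β 0 x := by
    filter_upwards [hv, hsuppv] with x h1 h2
    rcases le_or_gt ‖x‖ (0 + R) with hx | hx
    · exact mul_nonneg h1 (weight_pos hn hβ.le hx).le
    · simp [h2 hx]
  have h2 : 0 ≤ᵐ[volume] fun x => -(U 0 x * weightDeriv n R β 0 x) := by
    filter_upwards [hU, hsuppU] with x h1 h2
    rcases le_or_gt ‖x‖ (0 + R) with hx | hx
    · exact neg_nonneg.2 (mul_nonpos_of_nonneg_of_nonpos h1 (hneg x hx).le)
    · simp [h2 hx]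
  have hsum : wronskian R β U v 0 = (∫ x, v 0 x * weight n R β 0 x)
      + ∫ x, -(U 0 x * weightDeriv n R β 0 x) := by
    rw [integral_neg, wronskian, momentDeriv, sub_eq_add_neg]
  have p1 := integral_nonneg_of_ae h1
  have p2 := integral_nonneg_of_ae h2
  rw [hsum]
  refine lt_of_le_of_ne (by linarith) fun h0 => ?_
  have z1 : ∫ x, v 0 x * weight n R β 0 x = 0 := by linarith
  have z2 : ∫ x, -(U 0 x * weightDeriv n R β 0 x) = 0 := by linarith
  rw [integral_eq_zero_iff_of_nonneg_ae h1 hi1] at z1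
  rw [integral_eq_zero_iff_of_nonneg_ae h2 hi2.neg] at z2
  rcases hne with hne | hne
  · refine hne (Lp.ext ?_)
    filter_upwards [z2, hsuppU, Lp.coeFn_zero ℝ 2 (volume : Measure (Space n))] with x hx hs h0
    rw [h0]
    rcases le_or_gt ‖x‖ (0 + R) with hxR | hxR
    · exact (mul_eq_zero.1 (neg_eq_zero.1 hx)).resolve_right (hneg x hxR).ne
    · exact hs hxR
  · refine hne (Lp.ext ?_)
    filter_upwards [z1, hsuppv, Lp.coeFn_zero ℝ 2 (volume : Measure (Space n))] with x hx hs h0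
    rw [h0]
    rcases le_or_gt ‖x‖ (0 + R) with hxR | hxR
    · exact (mul_eq_zero.1 hx).resolve_right (weight_pos hn hβ.le hxR).ne'
    · exact hs hxR

end GlobalSolution

/-! ### Conclusion of the blow-up argument -/

theorem integral_inv_rpow_two_pow_le {r : ℝ} (hr : 1 ≤ r) (k : ℕ) :
    ∫ s in 1..(r * 2 ^ k), s ^ (-(1 : ℝ)) ≤ r * ((k : ℝ) + 1) := by
  have hpos : 0 < r * 2 ^ k := by positivity
  simp only [Real.rpow_neg_one]
  rw [integral_inv_of_pos one_pos hpos, div_one, Real.log_mul (by positivity) (by positivity),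
    Real.log_pow]
  have h1 := Real.log_le_sub_one_of_pos (by linarith : 0 < r)
  have h2 := Real.log_le_sub_one_of_pos (two_pos : (0 : ℝ) < 2)
  have hk : (0 : ℝ) ≤ k := Nat.cast_nonneg k
  nlinarith

theorem integral_rpow_neg_two_le {T : ℝ} (hT : 1 ≤ T) : ∫ s in 1..T, s ^ (-(2 : ℝ)) ≤ 1 := by
  rw [integral_rpow (Or.inr ⟨by norm_num, fun h => by rw [uIcc_of_le hT] at h; linarith [h.1]⟩)]
  have : 0 ≤ T ^ (-(2 : ℝ) + 1) := Real.rpow_nonneg (by linarith) _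
  rw [Real.one_rpow, show (-(2 : ℝ) + 1) = -1 by norm_num] at *
  linarith

namespace GlobalSolution

variable {p R : ℝ} {U v : ℝ → L2 n}

theorem wronskian_le (h : GlobalSolution p R U v) (hp : 0 < p) (hR : 0 < R) (hn : n ≠ 0) {β : ℝ}
    (hβ : 0 ≤ β) {s t : ℝ} (hs : 0 ≤ s) (hst : s ≤ t) :
    wronskian R β U v s ≤ wronskian R β U v t := by
  have hmono : MonotoneOn (wronskian R β U v) (Ici 0) := by
    refine monotoneOn_of_deriv_nonneg (convex_Ici 0) (h.continuousOn_wronskian hn β) ?_ ?_ <;>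
      rw [interior_Ici]
    · exact fun t ht =>
        (h.hasDerivAt_wronskian hR hp hn β ht).differentiableAt.differentiableWithinAt
    · intro t ht
      rw [(h.hasDerivAt_wronskian hR hp hn β ht).deriv]
      exact h.source_nonneg hp hn hβ (le_of_lt ht)
  exact hmono hs (hs.trans hst) hst

theorem not_nonneg_data (h : GlobalSolution p R U v) (hcrit : IsCriticalExponent n p) (hR : 0 < R)
    (hn : 2 ≤ n) (hU : ∀ᵐ x, 0 ≤ U 0 x) (hv : ∀ᵐ x, 0 ≤ v 0 x) (hne : U 0 ≠ 0 ∨ v 0 ≠ 0) :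
    False := by
  have hn0 : n ≠ 0 := by omega
  have hp1 := hcrit.one_lt hn
  have hp : 0 < p := hcrit.1
  obtain ⟨q, hpq⟩ : ∃ q, p.HolderConjugate q := ⟨_, Real.HolderConjugate.conjExponent hp1⟩
  have hq := hpq.symm.pos
  -- Any m ≥ (p+1)/(p-1) makes the cutoff flat enough at 2τ for `cutoff_bound`.
  obtain ⟨m, hm1, hm⟩ : ∃ m : ℕ, 1 ≤ m ∧ (m : ℝ) + 1 ≤ (m - 1) * p := by
    obtain ⟨m, hm⟩ := exists_nat_ge ((p + 1) / (p - 1))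
    have hpos : 0 < (p + 1) / (p - 1) := div_pos (by linarith) (by linarith)
    refine ⟨m, Nat.one_le_iff_ne_zero.2 ?_, ?_⟩
    · rintro rfl
      simp only [Nat.cast_zero] at hm
      linarith
    · rw [div_le_iff₀ (by linarith)] at hm
      linarith
  set κ := ((n : ℝ) - 1) / 2 with hκ
  have hpq1 : 1 / p + 1 / q = 1 := by simpa using hpq.inv_add_inv_eq_one
  have hβe : κ + 1 / q - 1 = κ - 1 / p := by linarith
  set β := κ - 1 / p with hβdef
  have hβ : 0 < β := by linarith [hcrit.inv_lt hn]
  set β' := κ + 2 / q - 1 with hβ'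
  have hβ'0 : 0 < β' := by
    have : 2 / q = 1 / q + 1 / q := by ring
    have : 0 < 1 / q := by positivity
    linarith
  -- With a = 1 the weight of the moment coincides with that of the source, at the price of a
  -- logarithm. With a = 2 the exponent rises to β' = β + 1/q and the logarithm disappears.
  obtain ⟨C₁, hC₁, hb₁⟩ := h.exists_moment_le hpq hcrit hR hn one_pos (by rw [← hκ, hβe]; exact hβ)
  obtain ⟨C₂, hC₂, hb₂⟩ := h.exists_moment_le hpq hcrit hR hn two_pos hβ'0
  rw [← hκ, hβe, ← hβdef] at hb₁
  rw [← hκ, ← hβ', ← hβdef] at hb₂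
  set L : ℝ → ℝ := fun t => wronskian R β U v t - wronskian R β U v 0 with hL
  have hI : 0 < wronskian R β U v 0 := h.wronskian_zero_pos hn0 hβ hU hv hne
  have hI' : 0 < wronskian R β' U v 0 := h.wronskian_zero_pos hn0 hβ'0 hU hv hne
  have hLd : ∀ t, 0 < t → HasDerivAt L (source p R β U t) t := fun t ht =>
    (h.hasDerivAt_wronskian hR hp hn0 β ht).sub_const _
  have hLc : ContinuousOn L (Ioi 0) := fun t ht => (hLd t ht).continuousAt.continuousWithinAt
  have hNc : ∀ b, ContinuousOn (wronskian R b U v) (Ioi 0) := fun b =>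
    (h.continuousOn_wronskian hn0 b).mono Ioi_subset_Ici_self
  have hLmono : ∀ {s t : ℝ}, 0 ≤ s → s ≤ t → L s ≤ L t := fun hs hst =>
    sub_le_sub_right (h.wronskian_le hp hR hn0 hβ.le hs hst) _
  have hS0 : ∀ t, 0 < t → 0 ≤ source p R β U t := fun t ht =>
    h.source_nonneg hp hn0 hβ.le ht.le
  set c : ℝ := 1 / ((m + 1) * (m + 2)) with hc
  have hc0 : 0 < c := by positivity
  have hct : ∀ {τ : ℝ}, 0 < τ → cutoffTail m τ τ = c := fun hτ => cutoffTail_left hτ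
  set X : ℝ → ℝ := fun τ => (∫ t in τ..(2 * τ), cutoff m τ t * L t) / τ with hX
  set V : ℝ → ℝ := fun τ => X τ - c * L τ with hV
  have hXL : ∀ τ, 0 < τ → c * L τ ≤ X τ := fun τ hτ => by
    rw [← hct hτ]
    exact le_integral_cutoff_mul hτ hLc fun t ht => hLmono hτ.le ht.1
  have hV0 : ∀ τ, 0 < τ → 0 ≤ V τ := fun τ hτ => sub_nonneg.2 (hXL τ hτ)
  set B : ℝ := 2 * ((2 * m + 3) * ((m + 1) * (m + 2))) with hB
  have hB0 : 0 < B := by positivity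
  have hJ0 : ∀ {a T : ℝ}, 1 ≤ T → 0 ≤ ∫ s in 1..T, s ^ (-a) := fun hT =>
    intervalIntegral.integral_nonneg hT fun s hs => Real.rpow_nonneg (by linarith [hs.1]) _
  -- The factor τ^(1/p) of the Hölder bound cancels against (V/τ)^(1/p): criticality makes the
  -- estimate scale invariant up to the s-integral.
  have avg : ∀ {C a b : ℝ}, 0 < C → (∀ τ, 1 ≤ τ → ∀ t ∈ Icc τ (2 * τ),
      |moment R b U t| ≤ τ * (C * τ ^ (1 / p) * (∫ s in 1..((R + 3) * τ), s ^ (-a)) ^ (1 / q) *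
        source p R β U t ^ (1 / p)) ∧
      |momentDeriv R b U t| ≤ C * τ ^ (1 / p) * (∫ s in 1..((R + 3) * τ), s ^ (-a)) ^ (1 / q) *
        source p R β U t ^ (1 / p)) → ∀ τ, 1 ≤ τ →
      (∫ t in τ..(2 * τ), cutoff m τ t * wronskian R b U v t) / τ
        ≤ B * C * (∫ s in 1..((R + 3) * τ), s ^ (-a)) ^ (1 / q) * V τ ^ (1 / p) := by
    intro C a b hC hb τ hτ
    have hτ0 : 0 < τ := by linarith
    have hJ : 0 ≤ ∫ s in 1..((R + 3) * τ), s ^ (-a) := hJ0 (by nlinarith)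
    have hVτ := hV0 τ hτ0
    have hav := average_le (K := C * τ ^ (1 / p) * (∫ s in 1..((R + 3) * τ), s ^ (-a)) ^ (1 / q))
      hp1 hm hm1 hτ0 (by positivity) (hNc b) (fun t ht => h.hasDerivAt_moment hn0 b ht) hLd hS0
      (fun t ht => (hb τ hτ t ht).1) (fun t ht => (hb τ hτ t ht).2) (by rw [hct hτ0]; exact hVτ)
    rw [hct hτ0] at hav
    refine hav.trans (le_of_eq ?_)
    change _ * (V τ / τ) ^ (1 / p) = _
    rw [Real.div_rpow hVτ hτ0.le, hB]
    field_simp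
  have hτk : ∀ k : ℕ, (1 : ℝ) ≤ 2 ^ k := fun k => one_le_pow₀ (by norm_num)
  have hτk0 : ∀ k : ℕ, (0 : ℝ) < 2 ^ k := fun k => by positivity
  have hlog : ∀ k : ℕ, X (2 ^ k)
      ≤ B * C₁ * (R + 3) ^ (1 / q) * ((k : ℝ) + 1) ^ (1 / q) * V (2 ^ k) ^ (1 / p) := by
    intro k
    have h1 : X (2 ^ k) ≤ (∫ t in (2 ^ k)..(2 * 2 ^ k),
        cutoff m (2 ^ k) t * wronskian R β U v t) / 2 ^ k := by
      refine div_le_div_of_nonneg_right ?_ (hτk0 k).le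
      refine intervalIntegral.integral_mono_on (by linarith [hτk0 k])
        (intervalIntegrable_cutoff_mul (hτk0 k) hLc)
        (intervalIntegrable_cutoff_mul (hτk0 k) (hNc β)) fun t ht => ?_
      exact mul_le_mul_of_nonneg_left (sub_le_self _ hI.le) (cutoff_nonneg (hτk0 k) ht)
    refine (h1.trans (avg hC₁ hb₁ _ (hτk k))).trans ?_
    have h2 := hV0 _ (hτk0 k)
    have h3 : (∫ s in 1..((R + 3) * 2 ^ k), s ^ (-(1 : ℝ))) ^ (1 / q)
        ≤ (R + 3) ^ (1 / q) * ((k : ℝ) + 1) ^ (1 / q) := by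
      rw [← Real.mul_rpow (by positivity) (by positivity)]
      exact Real.rpow_le_rpow (hJ0 (by nlinarith [hτk k]))
        (integral_inv_rpow_two_pow_le (by linarith) k) (by positivity)
    rw [mul_assoc (B * C₁) ((R + 3) ^ (1 / q))]
    gcongr
  -- The Wronskian at β' stays above its positive initial value while its average is at most B C₂
  -- V^(1/p), since ∫_1^∞ s^(-2) ds = 1. This is where the nonzero data enter quantitatively.
  have hlow : ∀ k : ℕ, (c * wronskian R β' U v 0 / (B * C₂)) ^ p ≤ V (2 ^ k) := by
    intro k
    have h0 := hV0 _ (hτk0 k)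
    have h1 := le_integral_cutoff_mul (m := m) (hτk0 k) (hNc β') (c := wronskian R β' U v 0)
      fun t ht => h.wronskian_le hp hR hn0 hβ'0.le le_rfl ((hτk0 k).le.trans ht.1)
    rw [hct (hτk0 k)] at h1
    have h2 := h1.trans (avg hC₂ hb₂ _ (hτk k))
    have hT : 1 ≤ (R + 3) * 2 ^ k := by nlinarith [hτk k]
    have h3 : (∫ s in 1..((R + 3) * 2 ^ k), s ^ (-(2 : ℝ))) ^ (1 / q) ≤ 1 :=
      Real.rpow_le_one (hJ0 hT) (integral_rpow_neg_two_le hT) (by positivity)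
    have h4 : c * wronskian R β' U v 0 ≤ B * C₂ * V (2 ^ k) ^ (1 / p) := by
      refine h2.trans ?_
      have : B * C₂ * (∫ s in 1..((R + 3) * 2 ^ k), s ^ (-(2 : ℝ))) ^ (1 / q) ≤ B * C₂ :=
        mul_le_of_le_one_right (by positivity) h3
      gcongr
    calc (c * wronskian R β' U v 0 / (B * C₂)) ^ p ≤ (V (2 ^ k) ^ (1 / p)) ^ p :=
          Real.rpow_le_rpow (by positivity) ((div_le_iff₀' (by positivity)).2 h4) hp.le
      _ = V (2 ^ k) := by rw [← Real.rpow_mul h0, one_div_mul_cancel hp.ne', Real.rpow_one]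
  refine false_of_growth (L := fun k => L (2 ^ k)) (V := fun k => V (2 ^ k)) hpq hc0
    (by positivity : 0 < (c * wronskian R β' U v 0 / (B * C₂)) ^ p)
    (by positivity : 0 < B * C₁ * (R + 3) ^ (1 / q)) ?_ hlow ?_ ?_ ?_
  · have := hLmono le_rfl (hτk0 0).le
    simpa [hL] using this
  · intro k
    refine le_trans ?_ (hlog k)
    have : 0 ≤ L (2 ^ k) := by simpa [hL] using hLmono le_rfl (hτk0 k).le
    exact sub_le_self _ (by positivity)
  · exact fun k => (hXL _ (hτk0 k)).trans (hlog k)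
  · intro k
    -- L is nondecreasing, so its weighted average over [τ, 2τ] is at most c L(2τ), and V is bounded
    -- by the increment of L over one dyadic step.
    have := integral_cutoff_mul_le (m := m) (hτk0 k) hLc (c := L (2 * 2 ^ k))
      fun t ht => hLmono ((hτk0 k).le.trans ht.1) ht.2
    rw [hct (hτk0 k)] at this
    rw [pow_succ', mul_sub]
    exact sub_le_sub_right this _

end GlobalSolution

theorem timeInterval_top : timeInterval ⊤ = Ici 0 := by
  ext t
  simp [timeInterval, EReal.coe_lt_top]

theorem H1.continuous_toL2 : Continuous (H1.toL2 (n := n)) :=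
  (WithLp.prod_continuous_ofLp 2 _ _).fst.comp continuous_subtype_val

theorem IsSolution.globalSolution {p R : ℝ} {u₀ : H1 n} {u₁ : L2 n} {u : ℝ → H1 n} {v : ℝ → L2 n}
    (h : IsSolution p u₀ u₁ ⊤ u v) (hcone : SupportedInCone R ⊤ u v) :
    GlobalSolution p R (fun t => H1.toL2 (u t)) v := by
  obtain ⟨hc, hd, hl, he, -, -⟩ := h
  rw [SupportedInCone] at hcone
  rw [timeInterval_top] at *
  refine ⟨fun t ht => ?_, fun t ht => ?_, H1.continuous_toL2.comp_continuousOn hc.fst, hc.snd,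
    fun t ht => hd t ht.le ht, hl, fun φ hφ t ht => he φ hφ t ht.le ht⟩
  · filter_upwards [hcone t ht] with x hx hxK
    exact (hx (not_le.1 fun h => hxK (mem_closedBall_zero_iff.2 h))).1
  · filter_upwards [hcone t ht] with x hx hxK
    exact (hx (not_le.1 fun h => hxK (mem_closedBall_zero_iff.2 h))).2

end CriticalWave

theorem theorem1p1 (n : ℕ) (hn : 2 ≤ n) (p : ℝ) (hp : CriticalWave.IsCriticalExponent n p)
    (R : ℝ) (hR : 0 < R)
    (u₀ : CriticalWave.H1 n) (u₁ : CriticalWave.L2 n)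
    (hsupp : ∀ᵐ x : CriticalWave.Space n, R < ‖x‖ → CriticalWave.H1.toL2 u₀ x = 0 ∧ u₁ x = 0)
    (hu₀ : ∀ᵐ x : CriticalWave.Space n, 0 ≤ CriticalWave.H1.toL2 u₀ x)
    (hu₁ : ∀ᵐ x : CriticalWave.Space n, 0 ≤ u₁ x)
    (hne : CriticalWave.H1.toL2 u₀ ≠ 0 ∨ u₁ ≠ 0)
    (T : EReal) (hT : 0 < T)
    (u : ℝ → CriticalWave.H1 n) (v : ℝ → CriticalWave.L2 n)
    (hsol : CriticalWave.IsSolution p u₀ u₁ T u v)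
    (hcone : CriticalWave.SupportedInCone R T u v) :
    T < ⊤ := by
  rw [lt_top_iff_ne_top]
  rintro rfl
  obtain rfl := hsol.initial_position
  obtain rfl := hsol.initial_velocity
  exact (hsol.globalSolution hcone).not_nonneg_data hp hR hn hu₀ hu₁ hne
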